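/- **Setting.** Let $\mathbf T$ be the complex unit circle and write $f_k=\frac1{2\pi}\int_0^{2\pi}f(e^{i\theta})e^{-ik\theta}\,d\theta$ ($k\in\mathbf Z$) for the Fourier coefficients of a function $f$ on $\mathbf T$. Let $\beta>1/2$, $\beta\notin\mathbf N$, and let $a:\mathbf T\to\mathbf C\setminus\{0\}$ be a function of class $C^\beta$ (that is, $a$ has $[\beta]$ continuous derivatives and the $[\beta]$th derivative is Hölder continuous with exponent $\beta-[\beta]$) whose winding number about the origin is zero. Let $\log a$ be a continuous logarithm of $a$ and put $$a_-(t)=\exp\sum_{k=1}^\infty(\log a)_{-k}t^{-k},\qquad a_+(t)=\exp\sum_{k=0}^\infty(\log a)_kt^k,\qquad b=a_-a_+^{-1},\qquad c=a_+a_-^{-1}.$$ For a function $f$ on $\mathbf T$ let $T_n(f)=(f_{j-k})_{j,k=1}^n$ and $D_n(f)=\det T_n(f)$ (with $D_0(f)=1$). For continuous $\varphi$ on $\mathbf T$ let $T(\varphi)=(\varphi_{j-k})_{j,k=1}^\infty$ and $H(\varphi)=(\varphi_{j+k-1})_{j,k=1}^\infty$, regarded as bounded operators on $\ell^2(\mathbf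 N)$, and let $\widetilde\varphi(t)=\varphi(1/t)$. Let $P_k$ be the projection $(x_1,x_2,\dots)\mapsto(x_1,\dots,x_k,0,0,\dots)$ on $\ell^2(\mathbf N)$ and $Q_k=I-P_k$. For an operator $X$ on $\ell^2(\mathbf N)$, $\det P_\kappa XP_\kappa$ denotes the determinant of the upper left $\kappa\times\kappa$ block of the matrix of $X$. **Theorem 1.3.** Let $n\ge 0$ and $\kappa>0$ be integers, and suppose that the matrix $T_{n+\kappa}(a)$ is invertible. Then the two operators $I-H(b)H(\widetilde c\,)Q_{n+\kappa}$ and $I-H(b)Q_nH(\widetilde c\,)Q_\kappa$ are invertible on $\ell^2(\mathbf N)$, and $$D_n(t^{-\kappa}a)=(-1)^{n\kappa}D_{n+\kappa}(a)F_{n,\kappa}(a),$$ where $$F_{n,\kappa}(a)=\det P_\kappa T(t^{-n})\bigl(I-H(b)H(\widetilde c\,)Q_{n+\kappa}\bigr)^{-1}T(b)P_\kappa=\det P_\kappa\bigl(I-H(b)Q_nH(\widetilde c\,)Q_\kappa\bigr)^{-1}T(t^{-n}b)P_\kappa.$$ -/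

import Mathlib

open scoped Real lp NNReal

noncomputable section

namespace SzegoJacobi

/-! ### Functions on the unit circle -/

/-- The `k`-th Fourier coefficient `(1/2π) ∫₀^{2π} f(e^{iθ}) e^{-ikθ} dθ`. -/
def fourierCoef (f : Circle → ℂ) (k : ℤ) : ℂ :=
  (1 / (2 * (π : ℂ))) *
    ∫ θ in (0 : ℝ)..(2 * π), f (Circle.exp θ) * Complex.exp (-(Complex.I * k * θ))

/-- The Hölder class `C^β` on the circle (`β > 0` not an integer), in the angular variable:
`f` has `⌊β⌋` continuous derivatives, and the last one is Hölder continuous with exponent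
`β - ⌊β⌋`. -/
def IsHolderClass (β : ℝ) (f : Circle → ℂ) : Prop :=
  ContDiff ℝ (⌊β⌋₊ : ℕ) (fun θ : ℝ => f (Circle.exp θ)) ∧
    ∃ C : ℝ≥0, HolderWith C (β - ⌊β⌋₊).toNNReal
      (iteratedDeriv ⌊β⌋₊ (fun θ : ℝ => f (Circle.exp θ)))

/-- `f : 𝕋 → ℂ \ {0}` has winding number `γ` about the origin: along a continuous branch of
the logarithm of `θ ↦ f(e^{iθ})`, one turn of the circle increases the logarithm by `2πiγ`. -/
def HasWindingNumber (f : Circle → ℂ) (γ : ℤ) : Prop :=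
  ∃ φ : ℝ → ℂ, Continuous φ ∧ (∀ θ : ℝ, Complex.exp (φ θ) = f (Circle.exp θ)) ∧
    ∀ θ : ℝ, φ (θ + 2 * π) = φ θ + 2 * π * Complex.I * γ

open Classical in
/-- A continuous logarithm of `a` on the circle. It exists if `a` is continuous without zeros and
has winding number zero; it is then unique up to an additive constant in `2πiℤ`, which changes
neither `a_-` nor `a_+` below. -/
def symbolLog (a : Circle → ℂ) : Circle → ℂ :=
  if h : ∃ l : Circle → ℂ, Continuous l ∧ ∀ t, Complex.exp (l t) = a t then h.choose else 0

/-- The Wiener-Hopf factor `a_-(t) = exp ∑_{k ≥ 1} (log a)_{-k} t^{-k}`. (For `a` of class `C^β`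
with `β > 1/2` the series is absolutely convergent, so the unconditional sum is the right one.) -/
def aMinus (a : Circle → ℂ) (t : Circle) : ℂ :=
  Complex.exp (∑' k : ℕ, fourierCoef (symbolLog a) (-((k : ℤ) + 1)) * (t : ℂ) ^ (-((k : ℤ) + 1)))

/-- The Wiener-Hopf factor `a_+(t) = exp ∑_{k ≥ 0} (log a)_k t^k`. -/
def aPlus (a : Circle → ℂ) (t : Circle) : ℂ :=
  Complex.exp (∑' k : ℕ, fourierCoef (symbolLog a) (k : ℤ) * (t : ℂ) ^ (k : ℤ))

/-- `b = a_- a_+⁻¹`. -/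
def symB (a : Circle → ℂ) (t : Circle) : ℂ := aMinus a t * (aPlus a t)⁻¹

/-- `c = a_+ a_-⁻¹`. -/
def symC (a : Circle → ℂ) (t : Circle) : ℂ := aPlus a t * (aMinus a t)⁻¹

/-- `f̃(t) = f(1/t)`. -/
def tilde (f : Circle → ℂ) (t : Circle) : ℂ := f t⁻¹

/-- `t ↦ t^m f(t)`. -/
def shiftSymbol (m : ℤ) (f : Circle → ℂ) (t : Circle) : ℂ := (t : ℂ) ^ m * f t

/-! ### Finite Toeplitz matrices -/

/-- `T_n(f) = (f_{j-k})`, an `n × n` matrix. -/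
def toeplitzMatrix (n : ℕ) (f : Circle → ℂ) : Matrix (Fin n) (Fin n) ℂ :=
  Matrix.of fun j k => fourierCoef f ((j : ℤ) - (k : ℤ))

/-- `D_n(f) = det T_n(f)`. -/
def toeplitzDet (n : ℕ) (f : Circle → ℂ) : ℂ := (toeplitzMatrix n f).det

/-! ### Operators on `ℓ²`

The coordinates of `ℓ²` are indexed by `0, 1, 2, …`, hence the shift by one or two of the indices
with respect to the usual indexing by `1, 2, 3, …`. -/

/-- The standard basis vectors of `ℓ²`. -/
def basisVec (k : ℕ) : ℓ²(ℕ, ℂ) := lp.single 2 k (1 : ℂ)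

open Classical in
/-- The bounded operator on `ℓ²` that is given by an infinite matrix. It is unique;
if the matrix does not induce a bounded operator the value is `0`. -/
def matrixOp (M : ℕ → ℕ → ℂ) : ℓ²(ℕ, ℂ) →L[ℂ] ℓ²(ℕ, ℂ) :=
  if h : ∃ A : ℓ²(ℕ, ℂ) →L[ℂ] ℓ²(ℕ, ℂ), ∀ j k, A (basisVec k) j = M j k then h.choose else 0

/-- The Toeplitz operator `T(φ) = (φ_{j-k})_{j,k ≥ 1}`; see `toeplitzOp_apply` below. -/
def toeplitzOp (φ : Circle → ℂ) : ℓ²(ℕ, ℂ) →L[ℂ] ℓ²(ℕ, ℂ) :=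
  matrixOp fun j k => fourierCoef φ ((j : ℤ) - k)

/-- The Hankel operator `H(φ) = (φ_{j+k-1})_{j,k ≥ 1}`; see `hankelOp_apply` below. -/
def hankelOp (φ : Circle → ℂ) : ℓ²(ℕ, ℂ) →L[ℂ] ℓ²(ℕ, ℂ) :=
  matrixOp fun j k => fourierCoef φ ((j : ℤ) + k + 1)

/-- The projection `P_k` onto the first `k` coordinates. -/
def projP (k : ℕ) : ℓ²(ℕ, ℂ) →L[ℂ] ℓ²(ℕ, ℂ) :=
  ∑ i ∈ Finset.range k, (innerSL ℂ (basisVec i)).smulRight (basisVec i)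

/-- The projection `Q_k = I - P_k`. -/
def projQ (k : ℕ) : ℓ²(ℕ, ℂ) →L[ℂ] ℓ²(ℕ, ℂ) := 1 - projP k

/-- For an operator of the form `P_κ X P_κ`, the determinant of its restriction to the
`κ`-dimensional range of `P_κ`, that is, of its upper left `κ × κ` block. -/
def cornerDet (κ : ℕ) (A : ℓ²(ℕ, ℂ) →L[ℂ] ℓ²(ℕ, ℂ)) : ℂ :=
  (Matrix.of fun j k : Fin κ => A (basisVec k) (j : ℕ)).det

/-! ### The definitions describe the intended operators -/

theorem basisVec_apply (k j : ℕ) : basisVec k j = if j = k then 1 else 0 := by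
  simp [basisVec, Pi.single_apply]

theorem projP_apply (k : ℕ) (x : ℓ²(ℕ, ℂ)) (j : ℕ) : projP k x j = if j < k then x j else 0 := by
  have h : ∀ i, inner ℂ (basisVec i) x = x i := fun i => by
    simp [basisVec, lp.inner_single_left]
  simp only [projP, _root_.sum_apply, ContinuousLinearMap.smulRight_apply,
    innerSL_apply_apply, h, lp.coeFn_sum, Finset.sum_apply, lp.coeFn_smul, Pi.smul_apply,
    basisVec_apply, smul_eq_mul, mul_ite, mul_one, mul_zero]
  simp

theorem projQ_apply (k : ℕ) (x : ℓ²(ℕ, ℂ)) (j : ℕ) : projQ k x j = if j < k then 0 else x j := by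
  have : projQ k x j = x j - projP k x j := by simp [projQ]
  rw [this, projP_apply]
  split_ifs <;> simp

theorem matrixOp_apply {M : ℕ → ℕ → ℂ}
    (h : ∃ A : ℓ²(ℕ, ℂ) →L[ℂ] ℓ²(ℕ, ℂ), ∀ j k, A (basisVec k) j = M j k) (j k : ℕ) :
    matrixOp M (basisVec k) j = M j k := by
  rw [matrixOp, dif_pos h]
  exact h.choose_spec j k

theorem fourierCoef_eq [Fact (0 < 2 * π)] (φ : Circle → ℂ) (k : ℤ) :
    fourierCoef φ k = fourierCoeff (fun x : AddCircle (2 * π) => φ (AddCircle.toCircle x)) k := by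
  rw [fourierCoeff_eq_intervalIntegral _ _ 0, fourierCoef, zero_add, Complex.real_smul]
  congr 1
  · push_cast
    rfl
  · refine intervalIntegral.integral_congr fun x _ => ?_
    have h : ((π : ℝ) : ℂ) ≠ 0 := Complex.ofReal_ne_zero.2 Real.pi_ne_zero
    have h' : (2 * π) / (2 * π) * x = x := by
      rw [div_self (by positivity), one_mul]
    simp only [fourier_coe_apply, smul_eq_mul, AddCircle.toCircle_apply_mk, h']
    rw [mul_comm]
    congr 2
    push_cast
    field_simp

/-- For continuous `φ` and injective `u`, `v`, the matrix `(φ_{u j - v k})` induces a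
bounded operator: a compression of the multiplication by `φ` on `L²`. -/
theorem exists_op (φ : Circle → ℂ) (hφ : Continuous φ) (u v : ℕ → ℤ)
    (hu : Function.Injective u) (hv : Function.Injective v) :
    ∃ A : ℓ²(ℕ, ℂ) →L[ℂ] ℓ²(ℕ, ℂ), ∀ j k, A (basisVec k) j = fourierCoef φ (u j - v k) := by
  have : Fact (0 < 2 * π) := ⟨Real.two_pi_pos⟩
  let μ : MeasureTheory.Measure (AddCircle (2 * π)) := AddCircle.haarAddCircle
  let g : C(AddCircle (2 * π), ℂ) :=
    ⟨fun x => φ (AddCircle.toCircle x), hφ.comp AddCircle.continuous_toCircle⟩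
  let M : MeasureTheory.Lp ℂ 2 μ →L[ℂ] MeasureTheory.Lp ℂ 2 μ :=
    (ContinuousLinearMap.mul ℂ ℂ).holderL μ ⊤ 2 2 (ContinuousMap.toLp ⊤ μ ℂ g)
  have hM : ∀ l, M (fourierLp 2 l) =ᵐ[μ] fun x => g x * fourier l x := fun l => by
    filter_upwards [(ContinuousLinearMap.mul ℂ ℂ).coeFn_holder (r := 2)
      (ContinuousMap.toLp ⊤ μ ℂ g) (fourierLp 2 l), ContinuousMap.coeFn_toLp (p := ⊤) (𝕜 := ℂ) μ g,
      coeFn_fourierLp 2 l] with x h1 h2 h3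
    refine h1.trans ?_
    rw [h2, h3]
    rfl
  have hin : ∀ m l, inner ℂ (fourierLp 2 m) (M (fourierLp 2 l)) = fourierCoef φ (m - l) := by
    intro m l
    rw [fourierCoef_eq, MeasureTheory.L2.inner_def, fourierCoeff]
    refine MeasureTheory.integral_congr_ae ?_
    filter_upwards [hM l, coeFn_fourierLp 2 m] with x h1 h2
    rw [h1, h2, RCLike.inner_apply', ← fourier_neg, neg_sub, sub_eq_neg_add, fourier_add,
      smul_eq_mul]
    change _ = _ * g x
    ring
  have hU := (orthonormal_fourier (T := 2 * π)).comp u hu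
  have hV := (orthonormal_fourier (T := 2 * π)).comp v hv
  let U := hU.orthogonalFamily.linearIsometry.toContinuousLinearMap
  let V := hV.orthogonalFamily.linearIsometry.toContinuousLinearMap
  refine ⟨(ContinuousLinearMap.adjoint U).comp (M.comp V), fun j k => ?_⟩
  have hUj : U (basisVec j) = fourierLp 2 (u j) := by
    refine (hU.orthogonalFamily.linearIsometry_apply_single (1 : ℂ)).trans ?_
    simp
  have hVk : V (basisVec k) = fourierLp 2 (v k) := by
    refine (hV.orthogonalFamily.linearIsometry_apply_single (1 : ℂ)).trans ?_
    simp
  have hj : ∀ x : ℓ²(ℕ, ℂ), x j = inner ℂ (basisVec j) x := fun x => by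
    simp [basisVec, lp.inner_single_left]
  rw [hj, ContinuousLinearMap.comp_apply, ContinuousLinearMap.adjoint_inner_right,
    ContinuousLinearMap.comp_apply, hUj, hVk, hin]

theorem toeplitzOp_apply (φ : Circle → ℂ) (hφ : Continuous φ) (j k : ℕ) :
    toeplitzOp φ (basisVec k) j = fourierCoef φ ((j : ℤ) - k) :=
  matrixOp_apply (exists_op φ hφ (fun j => (j : ℤ)) (fun k => (k : ℤ))
    Nat.cast_injective Nat.cast_injective) j k

theorem hankelOp_apply (φ : Circle → ℂ) (hφ : Continuous φ) (j k : ℕ) :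
    hankelOp φ (basisVec k) j = fourierCoef φ ((j : ℤ) + k + 1) := by
  refine matrixOp_apply (M := fun j k => fourierCoef φ ((j : ℤ) + k + 1)) ?_ j k
  obtain ⟨A, hA⟩ := exists_op φ hφ (fun j => (j : ℤ)) (fun k => -(k : ℤ) - 1)
    Nat.cast_injective (fun x y h => by simpa using h)
  exact ⟨A, fun j k => by rw [hA]; congr 1; ring⟩

end SzegoJacobi

end

noncomputable section

namespace SzegoJacobi

open MeasureTheory AddCircle

/-! The argument joins a Wiener-Hopf factorization to Jacobi's theorem on minors of an inverse
matrix.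

Write `N = n + κ`. Deleting the first `κ` rows and last `κ` columns of `T_N(a)` leaves
`T_n(t^{-κ}a)`. By Jacobi's theorem (`det_mul_det_corner_inverse`), its determinant is `(-1)^{nκ}
D_N(a)` times the lower left `κ × κ` minor of `R = T_N(a)⁻¹`. It remains to recognize this minor in
the two operator formulas.

A logarithm of `a` inherits a Hölder exponent above 1/2, so by Bernstein its Fourier series
converges absolutely. Hence `a = a_- a_+` with continuous, invertible factors. The operators
`T(a_-)`, `T(a_-⁻¹)` are upper triangular and `T(a_+)`, `T(a_+⁻¹)` lower triangular. Since `bc = 1`,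
`I - H(b)H(c̃) = T(b)T(c)` is a product of these four. Triangularity reduces invertibility of `I -
H(b)H(c̃)Q_N` to that of `T_N(a)`, and the inverse `X` satisfies `P_N X T(b) = T(a_-) R T(a_-)`
(`exists_inverse_of_triangular`). As `T(a_-)` has diagonal 1, the lower left minor of the right side
is that of `R`. Multiplication by `T(t^{-n})` moves it to the upper left corner, which is the first
formula.

For the second formula, `I - H(b)Q_nH(c̃)Q_κ` is the compression of `I - H(b)H(c̃)Q_N` by the shifts
`T(t^{-n})`, `T(t^n)`. The uncompressed operator is the identity on the range of `P_n`, so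
compression commutes with inversion (`compression_inverse`). -/

instance fact_two_pi_pos : Fact (0 < 2 * π) := ⟨Real.two_pi_pos⟩

/-! ### Fourier coefficients of continuous functions -/

/-- A function on the circle, as a function of the angle. -/
def angular (f : C(Circle, ℂ)) : C(AddCircle (2 * π), ℂ) :=
  f.comp ⟨AddCircle.toCircle, AddCircle.continuous_toCircle⟩

theorem angular_apply (f : C(Circle, ℂ)) (x : AddCircle (2 * π)) :
    angular f x = f (AddCircle.toCircle x) := rfl

theorem angular_coe (f : C(Circle, ℂ)) (θ : ℝ) : angular f θ = f (Circle.exp θ) := by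
  have h : (2 * π) / (2 * π) * θ = θ := by rw [div_self (by positivity), one_mul]
  rw [angular_apply, AddCircle.toCircle_apply_mk, h]

theorem fourierCoef_eq_angular (f : C(Circle, ℂ)) (k : ℤ) :
    fourierCoef f k = fourierCoeff (angular f) k := fourierCoef_eq f k

/-- The monomial `t ↦ t ^ m`. -/
def circlePow (m : ℤ) : C(Circle, ℂ) where
  toFun t := (t : ℂ) ^ m
  continuous_toFun := by
    have : (fun t : Circle => (t : ℂ) ^ m) = fun t : Circle => ((t ^ m : Circle) : ℂ) := by
      ext t; simp
    rw [this]
    exact continuous_subtype_val.comp (continuous_zpow m)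

theorem circlePow_apply (m : ℤ) (t : Circle) : circlePow m t = (t : ℂ) ^ m := rfl

theorem angular_circlePow (m : ℤ) : angular (circlePow m) = fourier m := by
  ext x
  simp [angular_apply, circlePow_apply, fourier_apply, AddCircle.toCircle_zsmul]

theorem norm_circlePow_le (m : ℤ) : ‖circlePow m‖ ≤ 1 :=
  (ContinuousMap.norm_le _ zero_le_one).2 fun t => by
    rw [circlePow_apply, norm_zpow, Circle.norm_coe, one_zpow]

theorem fourierCoef_circlePow (m k : ℤ) :
    fourierCoef (circlePow m) k = if k = m then 1 else 0 := by
  rw [fourierCoef_eq_angular, angular_circlePow, fourierCoeff_fourier, Pi.single_apply]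

theorem integrable_haar (f : C(AddCircle (2 * π), ℂ)) : Integrable f haarAddCircle :=
  f.continuous.integrable_of_hasCompactSupport (HasCompactSupport.of_compactSpace _)

/-- The Fourier coefficient as a continuous linear functional. -/
def coefCLM (k : ℤ) : C(Circle, ℂ) →L[ℂ] ℂ :=
  LinearMap.mkContinuous
    { toFun := fun f => fourierCoef f k
      map_add' := fun f g => by
        simp only [fourierCoef_eq_angular]
        exact congrFun (fourierCoeff.add (integrable_haar (angular f))
          (integrable_haar (angular g))) k
      map_smul' := fun c f => by
        simp only [fourierCoef_eq_angular]
        exact fourierCoeff.const_smul (angular f) c k } 1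
    (fun f => by
      simp only [LinearMap.coe_mk, AddHom.coe_mk, fourierCoef_eq_angular, one_mul]
      refine (norm_integral_le_of_norm_le_const (C := ‖f‖) (ae_of_all _ fun x => ?_)).trans ?_
      · rw [norm_smul, fourier_apply, Circle.norm_coe, one_mul]
        exact f.norm_coe_le_norm _
      · simp)

theorem coefCLM_apply (k : ℤ) (f : C(Circle, ℂ)) : coefCLM k f = fourierCoef f k := rfl

theorem fourierCoef_tilde (f : C(Circle, ℂ)) (k : ℤ) :
    fourierCoef (tilde f) k = fourierCoef f (-k) := by
  have h1 : Continuous (tilde f) := f.continuous.comp continuous_inv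
  rw [show tilde f = ((⟨tilde f, h1⟩ : C(Circle, ℂ)) : Circle → ℂ) from rfl,
    fourierCoef_eq_angular, fourierCoef_eq_angular, fourierCoeff, fourierCoeff,
    ← integral_neg_eq_self]
  refine integral_congr_ae (ae_of_all _ fun x => ?_)
  simp only [angular_apply, ContinuousMap.coe_mk, tilde, AddCircle.toCircle_neg, inv_inv,
    fourier_apply, smul_neg, neg_smul, neg_neg]

/-- The Fourier coefficients of a product are given by convolution. -/
theorem hasSum_fourierCoef_mul (f g : C(Circle, ℂ)) (n : ℤ) :
    HasSum (fun m => fourierCoef f (n - m) * fourierCoef g m)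
      (fourierCoef (fun t => f t * g t) n) := by
  -- Parseval is applied to `F = f̄ · e_n` and `g`, so that the inner product is the `n`-th
  -- coefficient of `fg`.
  let F : C(AddCircle (2 * π), ℂ) := star (angular f) * fourier n
  have h := (fourierBasis (T := 2 * π)).hasSum_inner_mul_inner
    (ContinuousMap.toLp (E := ℂ) 2 haarAddCircle ℂ F)
    (ContinuousMap.toLp (E := ℂ) 2 haarAddCircle ℂ (angular g))
  simp only [coe_fourierBasis, fourierLp, ContinuousMap.inner_toLp] at h
  have hF : ∀ x, (starRingEnd ℂ) (F x) = angular f x * fourier (-n) x := fun x => by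
    simp [F]
  have e1 : ∀ m, fourierCoef f (n - m) * fourierCoef g m =
      (∫ x, fourier m x * (starRingEnd ℂ) (F x) ∂haarAddCircle) *
        ∫ x, angular g x * (starRingEnd ℂ) (fourier m x) ∂haarAddCircle := fun m => by
    rw [fourierCoef_eq_angular, fourierCoef_eq_angular, fourierCoeff, fourierCoeff]
    congr 1
    · refine integral_congr_ae (ae_of_all _ fun x => ?_)
      simp only [hF, smul_eq_mul]
      rw [neg_sub, sub_eq_add_neg, fourier_add]
      ring
    · refine integral_congr_ae (ae_of_all _ fun x => ?_)
      simp only [smul_eq_mul, fourier_neg]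
      ring
  have e2 : fourierCoef (fun t => f t * g t) n =
      ∫ x, angular g x * (starRingEnd ℂ) (F x) ∂haarAddCircle := by
    rw [show (fun t => f t * g t) = ((f * g : C(Circle, ℂ)) : Circle → ℂ) from rfl,
      fourierCoef_eq_angular, fourierCoeff]
    refine integral_congr_ae (ae_of_all _ fun x => ?_)
    simp only [hF, smul_eq_mul, angular_apply, ContinuousMap.mul_apply]
    ring
  rw [e2]
  simpa only [e1] using h

theorem hasSum_circlePow {f : C(Circle, ℂ)} (h : Summable fun k => fourierCoef f k) (t : Circle) :
    HasSum (fun k : ℤ => fourierCoef f k * (t : ℂ) ^ k) (f t) := by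
  obtain ⟨x, rfl⟩ := (AddCircle.homeomorphCircle (T := 2 * π) (by positivity)).surjective t
  rw [AddCircle.homeomorphCircle_apply]
  have h' : Summable (fourierCoeff (angular f)) := by
    simpa only [fourierCoef_eq_angular] using! h
  have := has_pointwise_sum_fourier_series_of_summable h' x
  simpa only [fourierCoef_eq_angular, fourier_apply, angular_apply, smul_eq_mul,
    AddCircle.toCircle_zsmul, Circle.coe_zpow] using this

/-! ### Bernstein's theorem on absolutely convergent Fourier series -/

theorem fourierCoeff_translate (G : C(AddCircle (2 * π), ℂ)) (h : AddCircle (2 * π)) (k : ℤ) :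
    fourierCoeff (fun x => G (x + h)) k = fourier k h * fourierCoeff G k := by
  rw [fourierCoeff, fourierCoeff, ← integral_const_mul,
    ← integral_add_right_eq_self (fun x => fourier k h * (fourier (-k) x • G x)) h]
  refine integral_congr_ae (ae_of_all _ fun x => ?_)
  have : fourier k h * fourier (-k) (x + h) = fourier (-k) x := by
    simp only [fourier_apply, ← Circle.coe_mul, ← AddCircle.toCircle_add]
    congr 2
    simp only [smul_add, neg_smul]
    abel
  simp only [smul_eq_mul]
  rw [← mul_assoc, this]

/-- Parseval for `G(· + h) - G`, since translation multiplies the `k`-th coefficient by `e^{ikh}`.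
-/
theorem hasSum_sq_difference (G : C(AddCircle (2 * π), ℂ)) (h : AddCircle (2 * π)) :
    HasSum (fun k => ‖fourier k h - 1‖ ^ 2 * ‖fourierCoeff G k‖ ^ 2)
      (∫ x, ‖G (x + h) - G x‖ ^ 2 ∂haarAddCircle) := by
  let S : C(AddCircle (2 * π), ℂ) := ⟨fun x => G (x + h), by fun_prop⟩
  have hD := hasSum_sq_fourierCoeff (ContinuousMap.toLp (E := ℂ) 2 haarAddCircle ℂ (S - G))
  convert hD using 1
  · ext k
    rw [fourierCoeff_toLp, ← mul_pow, ← norm_mul]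
    congr 2
    have h1 := congrFun (fourierCoeff.add (integrable_haar S) (integrable_haar (-G))) k
    have h2 := fourierCoeff.const_smul G (-1) k
    have h3 : fourierCoeff S k = fourier k h * fourierCoeff G k := fourierCoeff_translate G h k
    have h4 : fourierCoeff (⇑(S - G)) k = fourierCoeff (⇑S + ⇑(-G)) k := by
      rw [sub_eq_add_neg]; rfl
    have h5 : fourierCoeff (⇑(-G)) k = fourierCoeff ((-1 : ℂ) • ⇑G) k := by
      rw [← ContinuousMap.coe_smul, neg_one_smul]
    rw [h4, h1, Pi.add_apply, h3, h5, h2, smul_eq_mul]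
    ring
  · refine integral_congr_ae ?_
    filter_upwards [ContinuousMap.coeFn_toLp (p := 2) (𝕜 := ℂ) haarAddCircle (S - G)] with x hx
    rw [hx]
    rfl

/-- Here `|e^{ix} - 1|² = 2 - 2 cos x`, and the cosine is nonpositive on this range. -/
theorem one_le_norm_fourier_sub_one {k : ℤ} {h : ℝ} (h1 : π / 2 ≤ |k * h|) (h2 : |k * h| ≤ π) :
    1 ≤ ‖fourier (T := 2 * π) k (h : AddCircle (2 * π)) - 1‖ ^ 2 := by
  have e : fourier (T := 2 * π) k (h : AddCircle (2 * π)) =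
      Complex.exp ((k * h : ℝ) * Complex.I) := by
    rw [fourier_coe_apply]
    congr 1
    have : ((π : ℝ) : ℂ) ≠ 0 := Complex.ofReal_ne_zero.2 Real.pi_ne_zero
    push_cast
    field_simp
  have hc : Real.cos (k * h) ≤ 0 := by
    rw [← Real.cos_abs]
    exact Real.cos_nonpos_of_pi_div_two_le_of_le h1 (by linarith [Real.pi_pos])
  rw [e, ← Complex.normSq_eq_norm_sq, Complex.normSq_apply]
  simp only [Complex.sub_re, Complex.sub_im, Complex.exp_ofReal_mul_I_re,
    Complex.exp_ofReal_mul_I_im, Complex.one_re, Complex.one_im]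
  nlinarith [Real.sin_sq_add_cos_sq (k * h : ℝ)]

/-- A weighted arithmetic-geometric mean bound, standing in for Cauchy-Schwarz on dyadic blocks. -/
theorem le_mul_sq_add_inv {w x : ℝ} (hw : 0 < w) (hx : 0 ≤ x) : x ≤ w * x ^ 2 + w⁻¹ := by
  have h : 0 ≤ w⁻¹ * (w * x - 1) ^ 2 := by positivity
  have e : w⁻¹ * (w * x - 1) ^ 2 = w * x ^ 2 - 2 * x + w⁻¹ := by
    field_simp
    ring
  linarith

/-- On the block `2^m ≤ |k| < 2^{m+1}`, translation by a step of order `2^{-m}` detects every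
coefficient, and Parseval bounds their squares by `O(2^{-2αm})`. Weighting the block by `w m` makes
the squares summable, while the remainders `(w m)⁻¹` are comparable to `|k|^{-(α + 1/2)}`. -/
theorem summable_fourierCoeff_of_holder (G : C(AddCircle (2 * π), ℂ)) {C α : ℝ} (hα : 1 / 2 < α)
    (hG : ∀ (x : AddCircle (2 * π)) (h : ℝ), 0 < h → ‖G (x + h) - G x‖ ≤ C * h ^ α) :
    Summable (fourierCoeff G) := by
  -- With this step `|k| * step m` lies in `[π/2, π]` on the whole block.
  let step : ℕ → ℝ := fun m => π / 2 * (2 ^ m)⁻¹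
  have hstep : ∀ m, 0 < step m := fun m => by positivity
  -- The exponent `α + 1/2` lies strictly between 1 and `2α`: both resulting series converge exactly
  -- because `α > 1/2`.
  let w : ℕ → ℝ := fun m => ((2 : ℝ) ^ m) ^ (α + 1 / 2)
  have hw : ∀ m, 0 < w m := fun m => by positivity
  let F : ℕ × ℤ → ℝ := fun p =>
    w p.1 * (‖fourier p.2 (step p.1 : AddCircle (2 * π)) - 1‖ ^ 2 * ‖fourierCoeff G p.2‖ ^ 2)
  have hF0 : 0 ≤ F := fun p => by have := hw p.1; positivity
  have hint : ∀ m, ∫ x, ‖G (x + (step m : AddCircle (2 * π))) - G x‖ ^ 2 ∂haarAddCircle ≤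
      (C * step m ^ α) ^ 2 := fun m => by
    have := norm_integral_le_of_norm_le_const (μ := haarAddCircle (T := 2 * π))
      (f := fun x => ‖G (x + (step m : AddCircle (2 * π))) - G x‖ ^ 2) (C := (C * step m ^ α) ^ 2)
      (ae_of_all _ fun x => by
        rw [Real.norm_of_nonneg (by positivity)]
        exact pow_le_pow_left₀ (norm_nonneg _) (hG x _ (hstep m)) 2)
    simpa using (le_abs_self _).trans this
  have hgeo : ∀ m, w m * (C * step m ^ α) ^ 2 =
      (C * (π / 2) ^ α) ^ 2 * ((2 : ℝ) ^ (1 / 2 - α)) ^ m := fun m => by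
    have e1 : step m ^ α = (π / 2) ^ α * ((2 : ℝ) ^ m) ^ (-α) := by
      rw [Real.mul_rpow (by positivity) (by positivity), Real.inv_rpow (by positivity),
        Real.rpow_neg (by positivity)]
    have e2 : ((2 : ℝ) ^ (1 / 2 - α)) ^ m =
        ((2 : ℝ) ^ m) ^ (α + 1 / 2) * (((2 : ℝ) ^ m) ^ (-α)) ^ 2 := by
      rw [← Real.rpow_natCast, ← Real.rpow_natCast 2 m, ← Real.rpow_natCast _ 2,
        ← Real.rpow_mul (by norm_num), ← Real.rpow_mul (by norm_num),
        ← Real.rpow_mul (by norm_num), ← Real.rpow_mul (by norm_num),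
        ← Real.rpow_add (by norm_num)]
      congr 1
      push_cast
      ring
    rw [e1, e2]
    simp only [w]
    ring
  have hF : Summable F := by
    refine (summable_prod_of_nonneg hF0).2 ⟨fun m => ?_, ?_⟩
    · exact (hasSum_sq_difference G (step m)).summable.mul_left (w m)
    · refine Summable.of_nonneg_of_le (fun m => tsum_nonneg fun k => hF0 _) (fun m => ?_)
        ((summable_geometric_of_lt_one (r := (2 : ℝ) ^ (1 / 2 - α)) (by positivity)
          (Real.rpow_lt_one_of_one_lt_of_neg (by norm_num) (by linarith))).mul_left
            ((C * (π / 2) ^ α) ^ 2))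
      rw [← hgeo]
      simp only [F]
      rw [tsum_mul_left, (hasSum_sq_difference G (step m)).tsum_eq]
      exact mul_le_mul_of_nonneg_left (hint m) (hw m).le
  -- Only the terms pairing `k` with its own dyadic block are kept from the double series.
  have hdiag : Summable fun k : ℤ => F (Nat.log 2 k.natAbs, k) :=
    hF.comp_injective fun a b h => (Prod.ext_iff.1 h).2
  have hpow : Summable fun k : ℤ => (2 : ℝ) ^ (α + 1 / 2) * |(k : ℝ)| ^ (-(α + 1 / 2)) :=
    (Real.summable_abs_int_rpow (by linarith)).mul_left _
  refine Summable.of_norm_bounded_eventually (hdiag.add hpow) ?_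
  -- The frequency 0 belongs to no dyadic block and is discarded as a finite exception.
  refine (Set.finite_singleton (0 : ℤ)).subset fun k hk => ?_
  by_contra hk0
  apply hk
  have hk0' : k.natAbs ≠ 0 := by simpa using hk0
  set m := Nat.log 2 k.natAbs with hm
  have l1 : (2 : ℝ) ^ m ≤ |(k : ℝ)| := by
    rw [← Int.cast_abs, Int.abs_eq_natAbs]
    exact_mod_cast Nat.pow_log_le_self 2 hk0'
  have l2 : |(k : ℝ)| ≤ 2 ^ m * 2 := by
    rw [← pow_succ, ← Int.cast_abs, Int.abs_eq_natAbs]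
    exact_mod_cast (Nat.lt_pow_succ_log_self (b := 2) (by norm_num) k.natAbs).le
  have hpm : (0 : ℝ) < 2 ^ m := by positivity
  have habs : |(k : ℝ) * step m| = |(k : ℝ)| * step m := by
    rw [abs_mul, abs_of_pos (hstep m)]
  have hstepm : (2 : ℝ) ^ m * step m = π / 2 := by
    simp only [step]
    field_simp
  have b1 : π / 2 ≤ |(k : ℝ) * step m| := by
    rw [habs, ← hstepm]
    exact mul_le_mul_of_nonneg_right l1 (hstep m).le
  have b2 : |(k : ℝ) * step m| ≤ π := by
    rw [habs]
    have := mul_le_mul_of_nonneg_right l2 (hstep m).le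
    linarith
  have key := one_le_norm_fourier_sub_one b1 b2
  have hkpos : (0 : ℝ) < |(k : ℝ)| := hpm.trans_le l1
  have hwinv : (w m)⁻¹ ≤ (2 : ℝ) ^ (α + 1 / 2) * |(k : ℝ)| ^ (-(α + 1 / 2)) := by
    rw [Real.rpow_neg hkpos.le, ← Real.inv_rpow hkpos.le,
      ← Real.mul_rpow (by norm_num) (by positivity)]
    simp only [w]
    rw [← Real.inv_rpow (by positivity)]
    refine Real.rpow_le_rpow (by positivity) ?_ (by linarith)
    rw [← div_eq_mul_inv, inv_le_comm₀ hpm (by positivity), inv_div,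
      div_le_iff₀ (by norm_num)]
    exact l2
  have hFk : w m * ‖fourierCoeff G k‖ ^ 2 ≤ F (m, k) := by
    refine mul_le_mul_of_nonneg_left ?_ (hw m).le
    exact le_mul_of_one_le_left (sq_nonneg _) key
  have hAM := le_mul_sq_add_inv (hw m) (norm_nonneg (fourierCoeff G k))
  exact hAM.trans (add_le_add hFk hwinv)

/-! ### The logarithm of the symbol -/

/-- For `β < 1` the exponent is `β`; for `β ≥ 1` the derivative is continuous and periodic, hence
bounded, and the exponent 1 suffices. -/
theorem IsHolderClass.exists_holder_bound {β : ℝ} (hβ : 1 / 2 < β) {f : Circle → ℂ}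
    (hf : IsHolderClass β f) :
    ∃ C α : ℝ, 1 / 2 < α ∧ ∀ x h : ℝ, 0 < h →
      ‖f (Circle.exp (x + h)) - f (Circle.exp x)‖ ≤ C * h ^ α := by
  obtain ⟨hd, C, hC⟩ := hf
  rcases lt_or_ge β 1 with h1 | h1
  · have h0 : ⌊β⌋₊ = 0 := Nat.floor_eq_zero.2 h1
    refine ⟨C, β, hβ, fun x h hh => ?_⟩
    have h2 := hC.dist_le (x + h) x
    have h3 : ((β - ⌊β⌋₊).toNNReal : ℝ) = β := by
      rw [h0, Nat.cast_zero, sub_zero, Real.coe_toNNReal _ (by linarith)]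
    rw [h3, h0, iteratedDeriv_zero, dist_eq_norm, Real.dist_eq, add_sub_cancel_left,
      abs_of_pos hh] at h2
    exact h2
  · have h2 : 1 ≤ ⌊β⌋₊ := Nat.le_floor (by simpa using h1)
    have hd1 : ContDiff ℝ 1 (fun θ : ℝ => f (Circle.exp θ)) := hd.of_le (by exact_mod_cast h2)
    have hper : Function.Periodic (fun θ : ℝ => f (Circle.exp θ)) (2 * π) := fun θ => by
      simp only [Circle.exp_add, Circle.exp_two_pi, mul_one]
    have hper' : Function.Periodic (deriv fun θ : ℝ => f (Circle.exp θ)) (2 * π) := fun θ => by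
      rw [← deriv_comp_add_const]
      congr 1
      ext x
      exact hper x
    obtain ⟨B, hB⟩ := (hper'.isBounded_of_continuous (by positivity)
      (hd1.continuous_deriv le_rfl)).exists_norm_le
    refine ⟨B, 1, by norm_num, fun x h hh => ?_⟩
    have := convex_univ.norm_image_sub_le_of_norm_deriv_le (𝕜 := ℝ) (x := x) (y := x + h)
      (fun y _ => (hd1.differentiable one_ne_zero) y) (fun y _ => hB _ ⟨y, rfl⟩)
      (Set.mem_univ _) (Set.mem_univ _)
    simpa [abs_of_pos hh] using this

/-- Zero winding makes the branch `φ` periodic, so it descends to the circle. -/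
theorem exists_continuous_log {a : Circle → ℂ} (haw : HasWindingNumber a 0) :
    ∃ l : Circle → ℂ, Continuous l ∧ ∀ t, Complex.exp (l t) = a t := by
  obtain ⟨φ, hφ, hexp, hper⟩ := haw
  have hper' : Function.Periodic φ (2 * π) := fun θ => by simpa using hper θ
  have hlift : Continuous hper'.lift := continuous_coinduced_dom.2 hφ
  refine ⟨fun t => hper'.lift (homeomorphCircle'.symm t),
    hlift.comp homeomorphCircle'.symm.continuous, fun t => ?_⟩
  obtain ⟨x, rfl⟩ := homeomorphCircle'.surjective t
  beta_reduce
  rw [Homeomorph.symm_apply_apply]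
  induction x using QuotientAddGroup.induction_on with
  | H θ => exact hexp θ

theorem symbolLog_spec {a : Circle → ℂ} (haw : HasWindingNumber a 0) :
    Continuous (symbolLog a) ∧ ∀ t, Complex.exp (symbolLog a t) = a t := by
  rw [symbolLog, dif_pos (exists_continuous_log haw)]
  exact (exists_continuous_log haw).choose_spec

/-- The quadratic remainder of the exponential absorbs at most half of `‖w‖`. -/
theorem norm_le_two_mul_norm_exp_sub_one {w : ℂ} (hw : ‖w‖ ≤ 1 / 2) :
    ‖w‖ ≤ 2 * ‖Complex.exp w - 1‖ := by
  have h1 := Complex.norm_exp_sub_one_sub_id_le (x := w) (by linarith)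
  have h2 : ‖w‖ ≤ ‖Complex.exp w - 1‖ + ‖Complex.exp w - 1 - w‖ := by
    have := norm_sub_le (Complex.exp w - 1) (Complex.exp w - 1 - w)
    rwa [sub_sub_cancel] at this
  nlinarith [norm_nonneg w]

/-- A logarithm of a Hölder continuous function is Hölder continuous. -/
theorem exists_holder_bound_log (G : C(AddCircle (2 * π), ℂ)) {C α : ℝ} (hα : 0 < α)
    (hG : ∀ (x : AddCircle (2 * π)) (h : ℝ), 0 < h →
      ‖Complex.exp (G (x + h)) - Complex.exp (G x)‖ ≤ C * h ^ α) :
    ∃ D : ℝ, ∀ (x : AddCircle (2 * π)) (h : ℝ), 0 < h → ‖G (x + h) - G x‖ ≤ D * h ^ α := by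
  obtain ⟨δ, hδ, hunif⟩ := Metric.uniformContinuous_iff.1
    (CompactSpace.uniformContinuous_of_continuous G.continuous) (1 / 2) (by norm_num)
  have hC : 0 ≤ C := by
    have := (norm_nonneg _).trans (hG 0 1 one_pos)
    simpa using this
  -- The first term serves `h < δ`, where increments of `G` are below 1/2 and the exponential can be
  -- inverted. The second serves `h ≥ δ`, where `(h / δ)^α ≥ 1` and the trivial bound `2‖G‖` is
  -- enough.
  refine ⟨2 * Real.exp ‖G‖ * C + 2 * ‖G‖ * δ ^ (-α), fun x h hh => ?_⟩
  rw [add_mul]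
  rcases lt_or_ge h δ with h1 | h1
  · have hd : dist (x + (h : AddCircle (2 * π))) x < δ := by
      rw [dist_eq_norm, add_sub_cancel_left]
      refine lt_of_le_of_lt (QuotientAddGroup.norm_mk_le_norm) ?_
      rwa [Real.norm_of_nonneg hh.le]
    have hw := (hunif hd).le
    rw [dist_eq_norm] at hw
    have h2 := norm_le_two_mul_norm_exp_sub_one hw
    have h3 : Complex.exp (G (x + h) - G x) - 1 =
        Complex.exp (-G x) * (Complex.exp (G (x + h)) - Complex.exp (G x)) := by
      rw [mul_sub, ← Complex.exp_add, ← Complex.exp_add, neg_add_cancel, Complex.exp_zero,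
        neg_add_eq_sub]
    have h4 : ‖Complex.exp (-G x)‖ ≤ Real.exp ‖G‖ := by
      rw [Complex.norm_exp]
      refine Real.exp_le_exp.2 ((Complex.re_le_norm _).trans ?_)
      rw [norm_neg]
      exact G.norm_coe_le_norm x
    rw [h3, norm_mul] at h2
    have h5 := mul_le_mul h4 (hG x h hh) (norm_nonneg _) (Real.exp_pos _).le
    have h6 : 0 ≤ 2 * ‖G‖ * δ ^ (-α) * h ^ α := by positivity
    linarith
  · have h2 : 1 ≤ δ ^ (-α) * h ^ α := by
      rw [Real.rpow_neg hδ.le, ← div_eq_inv_mul, one_le_div (by positivity)]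
      exact Real.rpow_le_rpow hδ.le h1 hα.le
    have h3 : ‖G (x + h) - G x‖ ≤ 2 * ‖G‖ := by
      have := norm_sub_le (G (x + h)) (G x)
      linarith [G.norm_coe_le_norm x, G.norm_coe_le_norm (x + h)]
    have h4 := le_mul_of_one_le_right (by positivity : 0 ≤ 2 * ‖G‖) h2
    have h5 : 0 ≤ 2 * Real.exp ‖G‖ * C * h ^ α := by positivity
    linarith

theorem summable_fourierCoef_symbolLog {β : ℝ} (hβ : 1 / 2 < β)
    {a : Circle → ℂ} (ha : IsHolderClass β a) (haw : HasWindingNumber a 0) :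
    Summable fun k => fourierCoef (symbolLog a) k := by
  obtain ⟨hl, hexp⟩ := symbolLog_spec haw
  obtain ⟨C, α, hα, hC⟩ := ha.exists_holder_bound hβ
  let l : C(Circle, ℂ) := ⟨symbolLog a, hl⟩
  have hE : ∀ θ : ℝ, Complex.exp (angular l θ) = a (Circle.exp θ) := fun θ => by
    rw [angular_coe]
    exact hexp _
  obtain ⟨D, hD⟩ := exists_holder_bound_log (angular l) (by linarith : 0 < α) (C := C)
    (fun x h hh => by
      induction x using QuotientAddGroup.induction_on with
      | H θ =>
        have := hC θ h hh
        rw [← hE, ← hE] at this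
        exact this)
  have := summable_fourierCoeff_of_holder (angular l) hα hD
  exact this.congr fun k => (fourierCoef_eq_angular l k).symm

/-! ### Wiener-Hopf factors -/

/-- The continuous functions whose Fourier coefficients are supported in a subsemigroup of `ℤ`. -/
def spectralSubalgebra (M : AddSubsemigroup ℤ) : NonUnitalSubalgebra ℂ C(Circle, ℂ) where
  carrier := {f | ∀ k ∉ M, coefCLM k f = 0}
  add_mem' hf hg k hk := by rw [map_add, hf k hk, hg k hk, add_zero]
  zero_mem' k _ := map_zero _
  smul_mem' c f hf k hk := by rw [map_smul, hf k hk, smul_zero]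
  mul_mem' {f g} hf hg k hk := by
    have h := hasSum_fourierCoef_mul f g k
    -- If `k ∉ M`, then `m` and `k - m` cannot both lie in `M`, so every convolution term vanishes.
    have h0 : (fun m => fourierCoef f (k - m) * fourierCoef g m) = fun _ => 0 := by
      ext m
      by_cases hm : m ∈ M
      · have : k - m ∉ M := fun h => hk (by simpa using M.add_mem h hm)
        rw [show fourierCoef f (k - m) = 0 from hf _ this, zero_mul]
      · rw [show fourierCoef g m = 0 from hg _ hm, mul_zero]
    rw [h0] at h
    exact h.unique hasSum_zero

theorem mem_spectralSubalgebra {M : AddSubsemigroup ℤ} {f : C(Circle, ℂ)} :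
    f ∈ spectralSubalgebra M ↔ ∀ k ∉ M, coefCLM k f = 0 := Iff.rfl

theorem isClosed_spectralSubalgebra (M : AddSubsemigroup ℤ) :
    IsClosed (spectralSubalgebra M : Set C(Circle, ℂ)) := by
  have : (spectralSubalgebra M : Set C(Circle, ℂ)) =
      ⋂ k : ℤ, ⋂ _ : k ∉ M, {f | coefCLM k f = 0} := by
    ext f
    simp [mem_spectralSubalgebra]
  rw [this]
  exact isClosed_iInter fun k => isClosed_iInter fun _ =>
    isClosed_eq (coefCLM k).continuous continuous_const

theorem circlePow_mem_spectralSubalgebra {M : AddSubsemigroup ℤ} {m : ℤ} (hm : m ∈ M) :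
    circlePow m ∈ spectralSubalgebra M := fun k hk => by
  rw [coefCLM_apply, fourierCoef_circlePow, if_neg]
  rintro rfl
  exact hk hm

theorem tsum_mem_spectralSubalgebra {M : AddSubsemigroup ℤ} (c : ℕ → ℂ) {u : ℕ → ℤ}
    (hu : ∀ i, u i ∈ M) : ∑' i, c i • circlePow (u i) ∈ spectralSubalgebra M :=
  tsum_mem (isClosed_spectralSubalgebra M) fun i =>
    SMulMemClass.smul_mem (c i) (circlePow_mem_spectralSubalgebra (hu i))

/-- Removing the constant term leaves only positive powers of `f`, so no unit is needed; this
matters for the negative integers. -/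
theorem exp_sub_one_mem_spectralSubalgebra {M : AddSubsemigroup ℤ} {f : C(Circle, ℂ)}
    (hf : f ∈ spectralSubalgebra M) : NormedSpace.exp f - 1 ∈ spectralSubalgebra M := by
  have h := (hasSum_nat_add_iff' 1).2 (NormedSpace.exp_series_hasSum_exp' (𝕂 := ℂ) f)
  simp only [Finset.range_one, Finset.sum_singleton, Nat.factorial_zero, Nat.cast_one, inv_one,
    pow_zero, one_smul] at h
  rw [← h.tsum_eq]
  refine tsum_mem (isClosed_spectralSubalgebra M) fun n =>
    SMulMemClass.smul_mem _ ?_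
  induction n with
  | zero => simpa using hf
  | succ n ih =>
    rw [pow_succ]
    exact (spectralSubalgebra M).mul_mem ih hf

theorem fourierCoef_exp {M : AddSubsemigroup ℤ} {f : C(Circle, ℂ)}
    (hf : f ∈ spectralSubalgebra M) {k : ℤ} (hk : k ∉ M) :
    fourierCoef (NormedSpace.exp f : C(Circle, ℂ)) k = if k = 0 then 1 else 0 := by
  have h := exp_sub_one_mem_spectralSubalgebra hf k hk
  have h1 : (1 : C(Circle, ℂ)) = circlePow 0 := by ext t; simp [circlePow_apply]
  rw [map_sub, sub_eq_zero, h1, coefCLM_apply, coefCLM_apply, fourierCoef_circlePow] at h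
  exact h

theorem exp_continuousMap_apply (f : C(Circle, ℂ)) (t : Circle) :
    (NormedSpace.exp f : C(Circle, ℂ)) t = Complex.exp (f t) := by
  have := NormedSpace.map_exp (ContinuousMap.evalAlgHom ℂ ℂ t)
    (ContinuousMap.evalCLM ℂ t).continuous f
  rw [Complex.exp_eq_exp_ℂ]
  exact this

theorem summable_smul_circlePow {c : ℕ → ℂ} (hc : Summable c) (u : ℕ → ℤ) :
    Summable fun i => c i • circlePow (u i) := by
  refine Summable.of_norm_bounded hc.norm fun i => ?_
  rw [norm_smul]
  exact mul_le_of_le_one_right (norm_nonneg _) (norm_circlePow_le _)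

theorem hasSum_smul_circlePow_apply {c : ℕ → ℂ} (hc : Summable c) (u : ℕ → ℤ) (t : Circle) :
    HasSum (fun i => c i * (t : ℂ) ^ u i) ((∑' i, c i • circlePow (u i)) t) :=
  (ContinuousMap.evalCLM ℂ t).hasSum (summable_smul_circlePow hc u).hasSum

/-- The nonnegative integers. -/
def nonnegInt : AddSubsemigroup ℤ := ⟨{k | 0 ≤ k}, fun hx hy => by
  simp only [Set.mem_ofPred_eq] at *; omega⟩

/-- The negative integers. -/
def negInt : AddSubsemigroup ℤ := ⟨{k | k < 0}, fun hx hy => by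
  simp only [Set.mem_ofPred_eq] at *; omega⟩

theorem mem_nonnegInt {k : ℤ} : k ∈ nonnegInt ↔ 0 ≤ k := by
  rw [nonnegInt, AddSubsemigroup.mem_mk, Set.mem_ofPred_eq]

theorem mem_negInt {k : ℤ} : k ∈ negInt ↔ k < 0 := by
  rw [negInt, AddSubsemigroup.mem_mk, Set.mem_ofPred_eq]

/-- The Wiener-Hopf factorization of a symbol whose logarithm has an absolutely convergent Fourier
series. -/
theorem exists_wienerHopf {a : Circle → ℂ} (haw : HasWindingNumber a 0)
    (hs : Summable fun k => fourierCoef (symbolLog a) k) :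
    ∃ p p' m m' : C(Circle, ℂ), (∀ t, p t = aPlus a t) ∧ (∀ t, m t = aMinus a t) ∧
      p * p' = 1 ∧ m * m' = 1 ∧ (∀ t, a t = m t * p t) ∧
      (∀ k < 0, fourierCoef p k = 0) ∧ (∀ k < 0, fourierCoef p' k = 0) ∧
      (∀ k > 0, fourierCoef m k = 0) ∧ (∀ k > 0, fourierCoef m' k = 0) ∧
      fourierCoef m 0 = 1 := by
  obtain ⟨hl, hexp⟩ := symbolLog_spec haw
  let l : C(Circle, ℂ) := ⟨symbolLog a, hl⟩
  have hsp : Summable fun k : ℕ => fourierCoef l k := hs.comp_injective Nat.cast_injective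
  have hsm : Summable fun k : ℕ => fourierCoef l (-((k : ℤ) + 1)) :=
    hs.comp_injective (i := fun k : ℕ => -((k : ℤ) + 1)) fun x y h => by simpa using h
  let fp : C(Circle, ℂ) := ∑' k : ℕ, fourierCoef l k • circlePow k
  let fm : C(Circle, ℂ) := ∑' k : ℕ, fourierCoef l (-((k : ℤ) + 1)) • circlePow (-((k : ℤ) + 1))
  have hp : fp ∈ spectralSubalgebra nonnegInt :=
    tsum_mem_spectralSubalgebra _ fun i => mem_nonnegInt.2 (Int.natCast_nonneg i)
  have hm : fm ∈ spectralSubalgebra negInt :=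
    tsum_mem_spectralSubalgebra _ fun i => mem_negInt.2 (by omega)
  have hpa : ∀ t : Circle, HasSum (fun k : ℕ => fourierCoef l k * (t : ℂ) ^ (k : ℤ)) (fp t) :=
    hasSum_smul_circlePow_apply hsp _
  have hma : ∀ t : Circle, HasSum
      (fun k : ℕ => fourierCoef l (-((k : ℤ) + 1)) * (t : ℂ) ^ (-((k : ℤ) + 1))) (fm t) :=
    hasSum_smul_circlePow_apply hsm _
  have hinv : ∀ f : C(Circle, ℂ), (NormedSpace.exp f : C(Circle, ℂ)) * NormedSpace.exp (-f) = 1 :=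
    fun f => by
      ext t
      simp [exp_continuousMap_apply, ← Complex.exp_add]
  have hnp : ∀ k < (0 : ℤ), k ∉ nonnegInt := fun k hk h => absurd (mem_nonnegInt.1 h) (by omega)
  have hnm : ∀ k ≥ (0 : ℤ), k ∉ negInt := fun k hk h => absurd (mem_negInt.1 h) (by omega)
  refine ⟨NormedSpace.exp fp, NormedSpace.exp (-fp), NormedSpace.exp fm, NormedSpace.exp (-fm),
    fun t => ?_, fun t => ?_, hinv _, hinv _, fun t => ?_, fun k hk => ?_, fun k hk => ?_,
    fun k hk => ?_, fun k hk => ?_, ?_⟩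
  · rw [exp_continuousMap_apply, ← (hpa t).tsum_eq]; rfl
  · rw [exp_continuousMap_apply, ← (hma t).tsum_eq]; rfl
  · rw [exp_continuousMap_apply, exp_continuousMap_apply, ← Complex.exp_add, ← hexp]
    congr 1
    rw [add_comm]
    exact (hasSum_circlePow (f := l) hs t).unique (HasSum.of_nat_of_neg_add_one
      (f := fun k : ℤ => fourierCoef l k * (t : ℂ) ^ k) (hpa t) (hma t))
  · rw [fourierCoef_exp hp (hnp k hk), if_neg hk.ne]
  · rw [fourierCoef_exp (neg_mem hp) (hnp k hk), if_neg hk.ne]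
  · rw [fourierCoef_exp hm (hnm k hk.le), if_neg hk.ne']
  · rw [fourierCoef_exp (neg_mem hm) (hnm k hk.le), if_neg hk.ne']
  · rw [fourierCoef_exp hm (hnm 0 le_rfl), if_pos rfl]

/-! ### Minors of the inverse matrix -/

theorem finRotate_pow_val (N k : ℕ) (i : Fin N) :
    (((finRotate N) ^ k) i : ℕ) = (i + k) % N := by
  obtain _ | M := N
  · exact i.elim0
  induction k with
  | zero => simp [Nat.mod_eq_of_lt i.isLt]
  | succ k ih =>
    rw [pow_succ', Equiv.Perm.mul_apply, finRotate_apply, Fin.val_add, ih, Fin.val_one',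
      ← Nat.add_mod, add_assoc]

/-- One rotation of `N = n + κ` points has sign `(-1)^{N-1}`, and `κ(κ - 1)` is even. -/
theorem sign_finRotate_pow (n κ : ℕ) :
    Equiv.Perm.sign ((finRotate (n + κ)) ^ κ) = (-1) ^ (n * κ) := by
  rw [map_pow, sign_finRotate, ← pow_mul]
  obtain _ | κ := κ
  · simp
  · have : (n + (κ + 1) - 1) * (κ + 1) = n * (κ + 1) + κ * (κ + 1) := by
      rw [← add_assoc, Nat.add_sub_cancel]
      ring
    rw [this, pow_add, (Nat.even_mul_succ_self κ).neg_one_pow, mul_one]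

/-- **Jacobi's theorem** on the complementary minors of the inverse matrix, for corner minors. -/
theorem det_mul_det_corner_inverse {R : Type*} [CommRing R] (n κ : ℕ)
    (A B : Matrix (Fin (n + κ)) (Fin (n + κ)) R) (hAB : A * B = 1) :
    A.det * (B.submatrix (Fin.natAdd n) (Fin.castLE (Nat.le_add_left κ n))).det =
      (-1) ^ (n * κ) *
        (Matrix.of fun j k : Fin n => A ⟨j + κ, by omega⟩ (Fin.castAdd κ k)).det := by
  let c : Fin κ → Fin (n + κ) := Fin.castLE (Nat.le_add_left κ n)
  let e : Fin n ⊕ Fin κ ≃ Fin (n + κ) := finSumFinEquiv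
  -- Permuting rows by `ρ` puts rows `κ, …, N - 1` on top and rows `0, …, κ - 1` below.
  let ρ : Equiv.Perm (Fin (n + κ)) := finRotate (n + κ) ^ κ
  have hl : ∀ j : Fin n, ρ (e (Sum.inl j)) = ⟨j + κ, by omega⟩ := fun j => by
    apply Fin.ext
    simp only [ρ, e, finSumFinEquiv_apply_left, finRotate_pow_val, Fin.val_castAdd]
    exact Nat.mod_eq_of_lt (by omega)
  have hr : ∀ k : Fin κ, ρ (e (Sum.inr k)) = c k := fun k => by
    apply Fin.ext
    simp only [ρ, e, c, finSumFinEquiv_apply_right, finRotate_pow_val, Fin.val_natAdd,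
      Fin.val_castLE]
    rw [add_assoc, add_comm, add_assoc, add_comm κ n, Nat.add_mod_right]
    exact Nat.mod_eq_of_lt (by omega)
  have hdetA : ((A.submatrix ρ id).submatrix e e).det = (-1) ^ (n * κ) * A.det := by
    rw [Matrix.det_submatrix_equiv_self, Matrix.det_permute, sign_finRotate_pow]
    push_cast
    ring
  -- The first `n` columns of the identity followed by the first `κ` columns of `B`. As `A * B = 1`,
  -- multiplying the permuted `A` by `C` yields a block triangular matrix with the wanted minor of
  -- `A` as one diagonal block and the identity as the other.
  let C : Matrix (Fin n ⊕ Fin κ) (Fin n ⊕ Fin κ) R :=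
    Matrix.fromBlocks 1 (B.submatrix (Fin.castAdd κ) c) 0 (B.submatrix (Fin.natAdd n) c)
  have hdetC : C.det = (B.submatrix (Fin.natAdd n) c).det := by
    rw [Matrix.det_fromBlocks_zero₂₁, Matrix.det_one, one_mul]
  have hBe : ∀ s k, C s (Sum.inr k) = B (e s) (c k) := by
    rintro (s | s) k <;> rfl
  have hCl : ∀ s k, C s (Sum.inl k) =
      (1 : Matrix (Fin n ⊕ Fin κ) (Fin n ⊕ Fin κ) R) s (Sum.inl k) := by
    rintro (s | s) k
    · simp [C, Matrix.one_apply]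
    · simp [C]
  have hmulr : ∀ s k, ((A.submatrix ρ id).submatrix e e * C) s (Sum.inr k) =
      (1 : Matrix (Fin (n + κ)) (Fin (n + κ)) R) (ρ (e s)) (c k) := fun s k => by
    rw [← hAB, Matrix.mul_apply, Matrix.mul_apply, ← e.sum_comp]
    exact Finset.sum_congr rfl fun x _ => by rw [hBe]; rfl
  have hmull : ∀ s k, ((A.submatrix ρ id).submatrix e e * C) s (Sum.inl k) =
      A (ρ (e s)) (e (Sum.inl k)) := fun s k => by
    rw [Matrix.mul_apply]
    simp only [hCl]
    rw [← Matrix.mul_apply, Matrix.mul_one]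
    rfl
  have hprod : (A.submatrix ρ id).submatrix e e * C = Matrix.fromBlocks
      (Matrix.of fun j k : Fin n => A ⟨j + κ, by omega⟩ (Fin.castAdd κ k)) 0
      (A.submatrix c (Fin.castAdd κ)) 1 := by
    ext (s | s) (k | k)
    · rw [hmull, hl]; rfl
    · rw [hmulr, hl, Matrix.one_apply_ne]
      · rfl
      · intro h
        have := congrArg Fin.val h
        simp only [c, Fin.val_castLE] at this
        omega
    · rw [hmull, hr]; rfl
    · rw [hmulr, hr, Matrix.fromBlocks_apply₂₂, Matrix.one_apply, Matrix.one_apply]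
      simp only [c, Fin.castLE_inj]
  have hdet := congrArg Matrix.det hprod
  rw [Matrix.det_mul, hdetA, hdetC, Matrix.det_fromBlocks_zero₁₂, Matrix.det_one, mul_one] at hdet
  rw [← hdet, ← mul_assoc, ← mul_assoc, ← pow_add, Even.neg_one_pow ⟨_, rfl⟩, one_mul]

/-- Multiplication by an upper unitriangular matrix on both sides does not change the lower left
minor. -/
theorem det_corner_upperTriangular_mul {R : Type*} [CommRing R] (n κ : ℕ)
    (U B : Matrix (Fin (n + κ)) (Fin (n + κ)) R) (hU : ∀ i j, j < i → U i j = 0)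
    (hU1 : ∀ i, U i i = 1) :
    ((U * B * U).submatrix (Fin.natAdd n) (Fin.castLE (Nat.le_add_left κ n))).det =
      (B.submatrix (Fin.natAdd n) (Fin.castLE (Nat.le_add_left κ n))).det := by
  let r : Fin κ → Fin (n + κ) := Fin.natAdd n
  let c : Fin κ → Fin (n + κ) := Fin.castLE (Nat.le_add_left κ n)
  have hdet : ∀ u : Fin κ → Fin (n + κ), StrictMono u → (U.submatrix u u).det = 1 := fun u hu => by
    have hT : (U.submatrix u u).IsUpperTriangular := fun i j h => hU _ _ (hu h)
    rw [Matrix.det_of_isUpperTriangular hT]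
    exact Finset.prod_eq_one fun i _ => hU1 _
  have hr : StrictMono r := fun i j h => Fin.lt_def.2 (by simpa [r] using h)
  have hc : StrictMono c := fun i j h => Fin.lt_def.2 (by simpa [c] using h)
  -- The last rows of `U` vanish outside the last columns, and its first columns vanish outside the
  -- first rows, so the minor factors through square blocks.
  have h : (U * B * U).submatrix r c = U.submatrix r r * B.submatrix r c * U.submatrix c c := by
    ext j k
    simp only [Matrix.submatrix_apply, Matrix.mul_apply]
    refine (Fintype.sum_of_injective c hc.injective _ _ (fun l hl => ?_) fun l => ?_).symm
    · rw [hU l (c k), mul_zero]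
      by_contra hlk
      rw [not_lt, Fin.le_def] at hlk
      simp only [c, Fin.val_castLE] at hlk
      exact hl ⟨⟨l, by omega⟩, rfl⟩
    · congr 1
      refine Fintype.sum_of_injective r hr.injective _ _ (fun i hi => ?_) fun i => rfl
      rw [hU (r j) i, zero_mul]
      by_contra hij
      rw [not_lt, Fin.le_def] at hij
      simp only [r, Fin.val_natAdd] at hij
      exact hi ⟨⟨i - n, by omega⟩, Fin.ext (by simp only [r, Fin.val_natAdd]; omega)⟩
  change ((U * B * U).submatrix r c).det = _
  rw [h, Matrix.det_mul, Matrix.det_mul, hdet r hr, hdet c hc, one_mul, mul_one]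

/-! ### Inversion of compressions in a ring -/

section Ring

variable {A : Type*} [Ring A]

theorem isUnit_and_inverse_eq {x y : A} (h1 : x * y = 1) (h2 : y * x = 1) :
    IsUnit x ∧ Ring.inverse x = y :=
  ⟨⟨⟨x, y, h1, h2⟩, rfl⟩, Ring.inverse_unit ⟨x, y, h1, h2⟩⟩

/-- If `1 - k = u * l * u' * l'` with `l`, `l'` and `u`, `u'` mutually inverse and triangular with
respect to the idempotent `p`, and `r` inverts the compression of `u * l'` to the range of `p`, then
`1 - k * (1 - p)` is invertible. -/
theorem exists_inverse_of_triangular {p l l' u u' r k : A}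
    (hll : l * l' = 1) (hll' : l' * l = 1) (huu : u * u' = 1) (huu' : u' * u = 1)
    (hpp : p * p = p) (hl : p * l = p * l * p) (hl' : p * l' = p * l' * p)
    (hu : u * p = p * u * p) (hu' : u' * p = p * u' * p)
    (hpr : p * r = r) (hrp : r * p = r) (h1 : r * (u * l') * p = p) (h2 : p * (u * l') * r = p)
    (hk : 1 - k = u * l * (u' * l')) :
    ∃ x, (1 - k * (1 - p)) * x = 1 ∧ x * (1 - k * (1 - p)) = 1 ∧ p * x * (u * l) = u * r * u := by
  have cl : ∀ z, l' * (l * z) = z := fun z => by rw [← mul_assoc, hll', one_mul]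
  have cl' : ∀ z, l * (l' * z) = z := fun z => by rw [← mul_assoc, hll, one_mul]
  have cu : ∀ z, u' * (u * z) = z := fun z => by rw [← mul_assoc, huu', one_mul]
  have cu' : ∀ z, u * (u' * z) = z := fun z => by rw [← mul_assoc, huu, one_mul]
  -- The inverse of `1 - k`, obtained by reversing its four factors.
  set m := l * (u * (l' * u')) with hm
  have hkm : (1 - k) * m = 1 := by
    rw [hk, hm]
    simp only [mul_assoc, cl, cl', cu, huu]
  have hmk : m * (1 - k) = 1 := by
    rw [hk, hm]
    simp only [mul_assoc, cl, cu, cu', hll]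
  -- The inverse of `p * m * p` on the range of `p`: triangularity factors that compression through
  -- those of `l`, `u * l'` and `u'`.
  set g := u * (r * l') with hg
  have hgp : g * p = g := by
    have : r * (l' * p) = r * l' := by
      rw [← hrp, mul_assoc, mul_assoc, ← mul_assoc p l' p, ← hl']
    rw [hg, mul_assoc, mul_assoc, this]
  have hpg : p * g = g := by
    have : p * (u * r) = u * r := by
      rw [← hpr, ← mul_assoc u, hu, ← mul_assoc, ← mul_assoc, ← mul_assoc, hpp]
    rw [hg, ← mul_assoc u, ← mul_assoc, this]
  have hgmp : g * (m * p) = p := by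
    have h3 : r * (u * (l' * (u' * p))) = u' * p := by
      have : r * (u * (l' * (p * (u' * p)))) = p * (u' * p) := by
        calc _ = r * (u * l') * p * (u' * p) := by simp only [mul_assoc]
          _ = _ := by rw [h1]
      rwa [← mul_assoc p, ← hu'] at this
    rw [hg, hm]
    simp only [mul_assoc, cl]
    rw [h3, cu']
  have hpmg : p * (m * g) = p := by
    have h3 : p * (l * (u * (l' * r))) = p * l := by
      calc _ = p * l * (u * (l' * r)) := by simp only [mul_assoc]
        _ = p * l * p * (u * (l' * r)) := by rw [← hl]
        _ = p * l * (p * (u * l') * r) := by simp only [mul_assoc]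
        _ = _ := by rw [h2, ← hl]
    rw [hg, hm]
    simp only [mul_assoc, cu]
    calc _ = p * (l * (u * (l' * r))) * l' := by simp only [mul_assoc]
      _ = _ := by rw [h3, mul_assoc, hll, mul_one]
  -- The second factor is block lower triangular, with diagonal blocks `p * m * p` and the identity.
  have hfac : 1 - k * (1 - p) = (1 - k) * (1 - p + m * p) := by
    have : (1 - k) * (m * p) = p := by rw [← mul_assoc, hkm, one_mul]
    rw [mul_add, this]
    noncomm_ring
  -- The block triangular inverse of `1 - p + m * p`.
  set w := g + (1 - p) - (1 - p) * (m * g) with hw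
  have e1 : w * (1 - p + m * p) = 1 := by
    calc _ = g - g * p + g * (m * p) + (1 - p - p + p * p) + (m * p - p * (m * p))
        - (1 - p) * (m * (g - g * p + g * (m * p))) := by rw [hw]; noncomm_ring
      _ = 1 := by rw [hgp, hgmp, hpp]; noncomm_ring
  have e2 : (1 - p + m * p) * w = 1 := by
    calc _ = (g - p * g) + (1 - p - p + p * p) - (m * g - p * (m * g) - p * (m * g) + p * p * (m * g))
        + m * (p * g) + m * (p - p * p) - m * (p - p * p) * (m * g) := by rw [hw]; noncomm_ring
      _ = 1 := by
        rw [hpg, hpp, hpmg]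
        noncomm_ring
  have e3 : p * w = g := by
    calc _ = p * g + (p - p * p) - (p - p * p) * (m * g) := by rw [hw]; noncomm_ring
      _ = g := by rw [hpg, hpp]; noncomm_ring
  refine ⟨w * m, ?_, ?_, ?_⟩
  · rw [hfac]
    calc _ = (1 - k) * ((1 - p + m * p) * w) * m := by simp only [mul_assoc]
      _ = 1 := by rw [e2, mul_one, hkm]
  · rw [hfac]
    calc _ = w * (m * (1 - k)) * (1 - p + m * p) := by simp only [mul_assoc]
      _ = 1 := by rw [hmk, mul_one, e1]
  · rw [← mul_assoc p, e3, hg, hm]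
    simp only [mul_assoc, cl, cu]
    rw [hll', mul_one]

/-- If `s * v = 1` and `y` is the identity on the range of `q = 1 - v * s`, then the compression
`s * y * v` is inverted by the compression of the inverse of `y`. -/
theorem compression_inverse {s v y x q : A} (hsv : s * v = 1) (hvs : v * s = 1 - q)
    (hyx : y * x = 1) (hxy : x * y = 1) (hyq : y * q = q) :
    s * y * v * (s * x * v) = 1 ∧ s * x * v * (s * y * v) = 1 ∧
      ∀ z, s * x * v * (s * z) = s * x * z := by
  have hsq : s * q = 0 := by
    have : q = 1 - v * s := by rw [hvs]; noncomm_ring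
    rw [this, mul_sub, ← mul_assoc, hsv]
    noncomm_ring
  have hxq : x * q = q := by
    calc x * q = x * (y * q) := by rw [hyq]
      _ = q := by rw [← mul_assoc, hxy, one_mul]
  have h3 : ∀ z, s * x * v * (s * z) = s * x * z := fun z => by
    calc _ = s * x * (v * s) * z := by simp only [mul_assoc]
      _ = s * x * z - s * (x * q) * z := by rw [hvs]; noncomm_ring
      _ = _ := by rw [hxq, hsq, zero_mul, sub_zero]
  refine ⟨?_, ?_, h3⟩
  · calc _ = s * y * (v * s) * x * v := by simp only [mul_assoc]
      _ = s * (y * x) * v - s * (y * q) * x * v := by rw [hvs]; noncomm_ring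
      _ = 1 := by rw [hyx, hyq, hsq]; simp [hsv]
  · rw [mul_assoc s y v, h3]
    calc _ = s * (x * y) * v := by simp only [mul_assoc]
      _ = 1 := by rw [hxy, mul_one, hsv]

end Ring

/-! ### Operators on `ℓ²` and their matrices -/

theorem hasSum_apply (A : ℓ²(ℕ, ℂ) →L[ℂ] ℓ²(ℕ, ℂ)) (x : ℓ²(ℕ, ℂ)) (j : ℕ) :
    HasSum (fun m => A (basisVec m) j * x m) (A x j) := by
  have h := (lp.hasSum_single (p := 2) (by norm_num) x).mapL A
  have h2 := h.mapL (innerSL ℂ (basisVec j))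
  have hj : ∀ y : ℓ²(ℕ, ℂ), innerSL ℂ (basisVec j) y = y j := fun y => by
    simp [basisVec, lp.inner_single_left]
  simp only [hj] at h2
  refine h2.congr_fun fun m => ?_
  have : lp.single 2 m (x m) = x m • basisVec m := by
    rw [basisVec, ← lp.single_smul, smul_eq_mul, mul_one]
  rw [this, map_smul, lp.coeFn_smul, Pi.smul_apply, smul_eq_mul, mul_comm]

theorem op_ext {A B : ℓ²(ℕ, ℂ) →L[ℂ] ℓ²(ℕ, ℂ)}
    (h : ∀ j k, A (basisVec k) j = B (basisVec k) j) : A = B := by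
  ext x j
  have h2 := hasSum_apply B x j
  simp only [← h] at h2
  exact (hasSum_apply A x j).unique h2

theorem projP_basisVec (N k : ℕ) : projP N (basisVec k) = if k < N then basisVec k else 0 := by
  ext j
  rw [projP_apply, basisVec_apply]
  split_ifs with h1 h2 h3 h3 <;> first | rfl | (simp [basisVec_apply]; try omega)

theorem projP_mul_apply (N : ℕ) (A : ℓ²(ℕ, ℂ) →L[ℂ] ℓ²(ℕ, ℂ)) (j k : ℕ) :
    (projP N * A) (basisVec k) j = if j < N then A (basisVec k) j else 0 := projP_apply _ _ _

theorem mul_projP_apply (N : ℕ) (A : ℓ²(ℕ, ℂ) →L[ℂ] ℓ²(ℕ, ℂ)) (j k : ℕ) :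
    (A * projP N) (basisVec k) j = if k < N then A (basisVec k) j else 0 := by
  rw [mul_apply_eq_comp, projP_basisVec]
  split_ifs <;> simp

theorem projP_mul_projP {k N : ℕ} (h : k ≤ N) : projP N * projP k = projP k := by
  refine op_ext fun i j => ?_
  rw [projP_mul_apply, projP_apply]
  split_ifs <;> first | rfl | omega

theorem projP_mul_eq_of_lower {A : ℓ²(ℕ, ℂ) →L[ℂ] ℓ²(ℕ, ℂ)}
    (h : ∀ j k, j < k → A (basisVec k) j = 0) (N : ℕ) : projP N * A = projP N * A * projP N := by
  refine op_ext fun i j => ?_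
  rw [mul_projP_apply, projP_mul_apply]
  split_ifs with h1 h2
  · rfl
  · exact h _ _ (by omega)
  · rfl
  · rfl

theorem mul_projP_eq_of_upper {A : ℓ²(ℕ, ℂ) →L[ℂ] ℓ²(ℕ, ℂ)}
    (h : ∀ j k, k < j → A (basisVec k) j = 0) (N : ℕ) : A * projP N = projP N * A * projP N := by
  refine op_ext fun i j => ?_
  rw [mul_projP_apply, mul_projP_apply, projP_mul_apply]
  split_ifs with h1 h2
  · rfl
  · exact h _ _ (by omega)
  · rfl

/-! ### Toeplitz and Hankel operators -/

theorem continuous_tilde (f : C(Circle, ℂ)) : Continuous (tilde f) :=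
  f.continuous.comp continuous_inv

theorem hankelOp_tilde_apply (f : C(Circle, ℂ)) (j k : ℕ) :
    hankelOp (tilde f) (basisVec k) j = fourierCoef f (-((j : ℤ) + k + 1)) := by
  rw [hankelOp_apply _ (continuous_tilde f), fourierCoef_tilde]

/-- The product formula for Toeplitz operators. -/
theorem toeplitzOp_mul (f g : C(Circle, ℂ)) :
    toeplitzOp (fun t => f t * g t) =
      toeplitzOp f * toeplitzOp g + hankelOp f * hankelOp (tilde g) := by
  refine op_ext fun j k => ?_
  have h1 := hasSum_apply (toeplitzOp f) (toeplitzOp g (basisVec k)) j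
  have h2 := hasSum_apply (hankelOp f) (hankelOp (tilde g) (basisVec k)) j
  simp only [toeplitzOp_apply _ f.continuous, toeplitzOp_apply _ g.continuous] at h1
  simp only [hankelOp_apply _ f.continuous, hankelOp_tilde_apply] at h2
  have h3 := hasSum_fourierCoef_mul f g ((j : ℤ) - k)
  rw [← (Equiv.subRight (k : ℤ)).hasSum_iff] at h3
  -- The convolution splits by the sign of the index: nonnegative indices give the Toeplitz product,
  -- negative ones the Hankel product.
  have h4 := HasSum.of_nat_of_neg_add_one
    (f := fun m : ℤ => fourierCoef f ((j : ℤ) - m) * fourierCoef g (m - k)) h1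
    (h2.congr_fun fun m => by congr 2; ring)
  rw [toeplitzOp_apply (fun t => f t * g t) (f.continuous.mul g.continuous)]
  refine h3.unique (h4.congr_fun fun m => ?_)
  simp only [Function.comp_apply, Equiv.subRight_apply]
  congr 2
  ring

theorem toeplitzOp_mul_of_nonpos {f : C(Circle, ℂ)} (hf : ∀ k > 0, fourierCoef f k = 0)
    (g : C(Circle, ℂ)) : toeplitzOp (fun t => f t * g t) = toeplitzOp f * toeplitzOp g := by
  have : hankelOp f = 0 := op_ext fun j k => by
    rw [hankelOp_apply _ f.continuous, hf _ (by omega)]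
    simp
  rw [toeplitzOp_mul, this, zero_mul, add_zero]

theorem toeplitzOp_mul_of_nonneg (f : C(Circle, ℂ)) {g : C(Circle, ℂ)}
    (hg : ∀ k < 0, fourierCoef g k = 0) :
    toeplitzOp (fun t => f t * g t) = toeplitzOp f * toeplitzOp g := by
  have : hankelOp (tilde g) = 0 := op_ext fun j k => by
    rw [hankelOp_tilde_apply, hg _ (by omega)]
    simp
  rw [toeplitzOp_mul, this, mul_zero, add_zero]

theorem toeplitzOp_one : toeplitzOp (1 : C(Circle, ℂ)) = 1 := by
  refine op_ext fun j k => ?_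
  have h1 : (1 : C(Circle, ℂ)) = circlePow 0 := by ext t; simp [circlePow_apply]
  rw [h1, toeplitzOp_apply _ (circlePow 0).continuous, fourierCoef_circlePow,
    one_apply_eq_self, basisVec_apply]
  congr 1
  exact propext (by omega)

theorem toeplitzOp_circlePow_basisVec (n k : ℕ) :
    toeplitzOp (circlePow n) (basisVec k) = basisVec (k + n) := by
  ext j
  rw [toeplitzOp_apply _ (circlePow n).continuous, fourierCoef_circlePow, basisVec_apply]
  congr 1
  exact propext (by omega)

theorem toeplitzOp_circlePow_neg_apply (n : ℕ) (x : ℓ²(ℕ, ℂ)) (j : ℕ) :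
    toeplitzOp (circlePow (-n)) x j = x (j + n) := by
  have h := hasSum_apply (toeplitzOp (circlePow (-n))) x j
  refine h.unique ?_
  convert hasSum_ite_eq (j + n) (x (j + n)) using 2 with m
  rw [toeplitzOp_apply _ (circlePow _).continuous, fourierCoef_circlePow]
  by_cases hm : m = j + n
  · subst hm
    simp
  · rw [if_neg hm, if_neg (by omega), zero_mul]

theorem toeplitzOp_circlePow_neg_mul (n : ℕ) :
    toeplitzOp (circlePow (-n)) * toeplitzOp (circlePow n) = 1 := by
  refine op_ext fun j k => ?_
  rw [mul_apply_eq_comp, toeplitzOp_circlePow_neg_apply, toeplitzOp_circlePow_basisVec,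
    one_apply_eq_self, basisVec_apply, basisVec_apply]
  simp

theorem toeplitzOp_circlePow_mul_neg (n : ℕ) :
    toeplitzOp (circlePow n) * toeplitzOp (circlePow (-n)) = projQ n := by
  refine op_ext fun j k => ?_
  rw [projQ_apply]
  by_cases hk : n ≤ k
  · have : toeplitzOp (circlePow (-n)) (basisVec k) = basisVec (k - n) := by
      ext i
      rw [toeplitzOp_circlePow_neg_apply, basisVec_apply, basisVec_apply]
      congr 1
      exact propext (by omega)
    rw [mul_apply_eq_comp, this, toeplitzOp_circlePow_basisVec, Nat.sub_add_cancel hk]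
    split_ifs with h
    · rw [basisVec_apply, if_neg (by omega)]
    · rfl
  · have : toeplitzOp (circlePow (-n)) (basisVec k) = 0 := by
      ext i
      rw [toeplitzOp_circlePow_neg_apply, basisVec_apply, if_neg (by omega)]
      rfl
    rw [mul_apply_eq_comp, this, map_zero, basisVec_apply]
    split_ifs <;> first | rfl | omega

/-- A Hankel matrix depends only on `j + k`, so shifting its columns equals shifting its rows. -/
theorem hankelOp_mul_toeplitzOp_circlePow (f : C(Circle, ℂ)) (n : ℕ) :
    hankelOp f * toeplitzOp (circlePow n) = toeplitzOp (circlePow (-n)) * hankelOp f := by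
  refine op_ext fun j k => ?_
  rw [mul_apply_eq_comp, mul_apply_eq_comp, toeplitzOp_circlePow_basisVec,
    toeplitzOp_circlePow_neg_apply, hankelOp_apply _ f.continuous, hankelOp_apply _ f.continuous]
  congr 1
  push_cast
  ring

theorem toeplitzOp_circlePow_mul_projQ (n κ : ℕ) :
    toeplitzOp (circlePow n) * projQ κ = projQ (n + κ) * toeplitzOp (circlePow n) := by
  refine op_ext fun j k => ?_
  have : projQ κ (basisVec k) = if k < κ then 0 else basisVec k := by
    rw [projQ, _root_.sub_apply, one_apply_eq_self, projP_basisVec]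
    split_ifs <;> simp
  rw [mul_apply_eq_comp, mul_apply_eq_comp, toeplitzOp_circlePow_basisVec,
    projQ_apply, this]
  by_cases hk : k < κ
  · rw [if_pos hk, map_zero, basisVec_apply]
    split_ifs <;> first | rfl | omega
  · rw [if_neg hk, toeplitzOp_circlePow_basisVec, basisVec_apply]
    split_ifs <;> first | rfl | omega

/-! ### Finite matrices as operators -/

/-- The operator on `ℓ²` whose matrix is `R`, extended by zero. -/
def extendOp {N : ℕ} (R : Matrix (Fin N) (Fin N) ℂ) : ℓ²(ℕ, ℂ) →L[ℂ] ℓ²(ℕ, ℂ) :=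
  ∑ i, ∑ l, R i l • (innerSL ℂ (basisVec l)).smulRight (basisVec i)

theorem extendOp_eq {N : ℕ} (R : Matrix (Fin N) (Fin N) ℂ) (x : ℓ²(ℕ, ℂ)) :
    extendOp R x = ∑ i, (∑ l, R i l * x l) • basisVec i := by
  have h : ∀ i, inner ℂ (basisVec i) x = x i := fun i => by
    simp [basisVec, lp.inner_single_left]
  simp [extendOp, _root_.sum_apply, h, Finset.sum_smul, mul_smul]

/-- The upper left `N × N` block. -/
def cornerMatrix (N : ℕ) (A : ℓ²(ℕ, ℂ) →L[ℂ] ℓ²(ℕ, ℂ)) : Matrix (Fin N) (Fin N) ℂ :=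
  Matrix.of fun j k => A (basisVec k) j

theorem mul_extendOp_mul_apply {N : ℕ} (A B : ℓ²(ℕ, ℂ) →L[ℂ] ℓ²(ℕ, ℂ))
    (R : Matrix (Fin N) (Fin N) ℂ) (j k : Fin N) :
    (A * extendOp R * B) (basisVec k) j = (cornerMatrix N A * R * cornerMatrix N B) j k := by
  rw [mul_apply_eq_comp, mul_apply_eq_comp, extendOp_eq, map_sum,
    lp.coeFn_sum, Finset.sum_apply, Matrix.mul_assoc, Matrix.mul_apply]
  refine Finset.sum_congr rfl fun i _ => ?_
  rw [map_smul, lp.coeFn_smul, Pi.smul_apply, smul_eq_mul, mul_comm, Matrix.mul_apply]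
  rfl

theorem cornerMatrix_one (N : ℕ) : cornerMatrix N 1 = 1 := by
  ext j k
  rw [cornerMatrix, Matrix.of_apply, one_apply_eq_self, basisVec_apply,
    Matrix.one_apply]
  simp only [Fin.ext_iff]

theorem extendOp_apply_of_le {N : ℕ} (R : Matrix (Fin N) (Fin N) ℂ) (x : ℓ²(ℕ, ℂ)) {j : ℕ}
    (hj : N ≤ j) : extendOp R x j = 0 := by
  rw [extendOp_eq, lp.coeFn_sum, Finset.sum_apply]
  refine Finset.sum_eq_zero fun i _ => ?_
  rw [lp.coeFn_smul, Pi.smul_apply, basisVec_apply, if_neg (by omega), smul_zero]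

theorem extendOp_basisVec_of_le {N : ℕ} (R : Matrix (Fin N) (Fin N) ℂ) {k : ℕ}
    (hk : N ≤ k) : extendOp R (basisVec k) = 0 := by
  rw [extendOp_eq]
  refine Finset.sum_eq_zero fun i _ => ?_
  rw [Finset.sum_eq_zero, zero_smul]
  intro l _
  rw [basisVec_apply, if_neg (by omega), mul_zero]

theorem projP_mul_extendOp {N : ℕ} (R : Matrix (Fin N) (Fin N) ℂ) :
    projP N * extendOp R = extendOp R := by
  refine op_ext fun j k => ?_
  rw [projP_mul_apply]
  split_ifs with h
  · rfl
  · rw [extendOp_apply_of_le R _ (not_lt.1 h)]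

theorem extendOp_mul_projP {N : ℕ} (R : Matrix (Fin N) (Fin N) ℂ) :
    extendOp R * projP N = extendOp R := by
  refine op_ext fun j k => ?_
  rw [mul_projP_apply]
  split_ifs with h
  · rfl
  · rw [extendOp_basisVec_of_le R (not_lt.1 h)]
    rfl

theorem extendOp_mul_mul_projP {N : ℕ} {R : Matrix (Fin N) (Fin N) ℂ}
    {A : ℓ²(ℕ, ℂ) →L[ℂ] ℓ²(ℕ, ℂ)} (h : R * cornerMatrix N A = 1) :
    extendOp R * A * projP N = projP N := by
  refine op_ext fun j k => ?_
  rw [mul_projP_apply, projP_apply, basisVec_apply]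
  by_cases hk : k < N
  · by_cases hj : j < N
    · have := mul_extendOp_mul_apply 1 A R ⟨j, hj⟩ ⟨k, hk⟩
      rw [one_mul, cornerMatrix_one, Matrix.one_mul, h, Matrix.one_apply] at this
      simpa [hk, hj] using this
    · rw [if_pos hk, if_neg hj]
      exact extendOp_apply_of_le R _ (not_lt.1 hj)
  · rw [if_neg hk]
    split_ifs <;> first | rfl | omega

theorem projP_mul_mul_extendOp {N : ℕ} {R : Matrix (Fin N) (Fin N) ℂ}
    {A : ℓ²(ℕ, ℂ) →L[ℂ] ℓ²(ℕ, ℂ)} (h : cornerMatrix N A * R = 1) :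
    projP N * A * extendOp R = projP N := by
  refine op_ext fun j k => ?_
  rw [mul_assoc, projP_mul_apply, projP_apply, basisVec_apply]
  by_cases hk : k < N
  · by_cases hj : j < N
    · have := mul_extendOp_mul_apply A 1 R ⟨j, hj⟩ ⟨k, hk⟩
      rw [mul_one, cornerMatrix_one, Matrix.mul_one, h, Matrix.one_apply] at this
      simpa [hj] using this
    · rw [if_neg hj, if_neg hj]
  · rw [mul_apply_eq_comp, extendOp_basisVec_of_le R (not_lt.1 hk), map_zero]
    split_ifs <;> first | rfl | omega

/-! ### Shifted symbols and corner determinants -/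

theorem fourierCoef_shiftSymbol (f : C(Circle, ℂ)) (m k : ℤ) :
    fourierCoef (shiftSymbol m f) k = fourierCoef f (k - m) := by
  refine (hasSum_fourierCoef_mul (circlePow m) f k).unique ?_
  refine (hasSum_ite_eq (k - m) (fourierCoef f (k - m))).congr_fun fun i => ?_
  rw [fourierCoef_circlePow]
  by_cases hi : i = k - m
  · rw [if_pos hi, if_pos (by omega), hi, one_mul]
  · rw [if_neg hi, if_neg (by omega), zero_mul]

theorem cornerDet_projP (κ : ℕ) (A : ℓ²(ℕ, ℂ) →L[ℂ] ℓ²(ℕ, ℂ)) :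
    cornerDet κ (projP κ * A * projP κ) = (cornerMatrix κ A).det := by
  rw [cornerDet]
  congr 1
  ext j k
  rw [Matrix.of_apply, mul_projP_apply, if_pos k.isLt, projP_mul_apply, if_pos j.isLt]
  rfl

/-- The determinant of the shifted Toeplitz matrix is the lower left minor of the inverse matrix. -/
theorem toeplitzDet_shiftSymbol (a : C(Circle, ℂ)) (n κ : ℕ)
    (hT : IsUnit (toeplitzMatrix (n + κ) a)) :
    toeplitzDet n (shiftSymbol (-(κ : ℤ)) a) = (-1) ^ (n * κ) * toeplitzDet (n + κ) a *
      ((toeplitzMatrix (n + κ) a)⁻¹.submatrix (Fin.natAdd n)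
        (Fin.castLE (Nat.le_add_left κ n))).det := by
  have h := det_mul_det_corner_inverse n κ (toeplitzMatrix (n + κ) a) (toeplitzMatrix (n + κ) a)⁻¹
    (Matrix.mul_nonsing_inv _ ((Matrix.isUnit_iff_isUnit_det _).1 hT))
  rw [mul_assoc, toeplitzDet, toeplitzDet, h, ← mul_assoc, ← pow_add, Even.neg_one_pow ⟨_, rfl⟩,
    one_mul]
  congr 1
  ext j k
  simp only [toeplitzMatrix, Matrix.of_apply, fourierCoef_shiftSymbol]
  congr 1
  simp only [Fin.val_castAdd]
  push_cast
  ring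

end SzegoJacobi

end

/-! ### The determinant identity -/

open SzegoJacobi in
theorem theorem1p3 (β : ℝ) (hβ : 1 / 2 < β) (hβN : ∀ m : ℕ, β ≠ m)
    (a : Circle → ℂ) (ha : IsHolderClass β a) (ha0 : ∀ t, a t ≠ 0) (haw : HasWindingNumber a 0)
    (n κ : ℕ) (hκ : 0 < κ) (hT : IsUnit (toeplitzMatrix (n + κ) a)) :
    IsUnit (1 - hankelOp (symB a) * hankelOp (tilde (symC a)) * projQ (n + κ)) ∧
    IsUnit (1 - hankelOp (symB a) * projQ n * hankelOp (tilde (symC a)) * projQ κ) ∧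
    ∃ F : ℂ,
      toeplitzDet n (shiftSymbol (-(κ : ℤ)) a) = (-1) ^ (n * κ) * toeplitzDet (n + κ) a * F ∧
      F = cornerDet κ (projP κ * toeplitzOp (fun t => (t : ℂ) ^ (-(n : ℤ))) *
        Ring.inverse (1 - hankelOp (symB a) * hankelOp (tilde (symC a)) * projQ (n + κ)) *
        toeplitzOp (symB a) * projP κ) ∧
      F = cornerDet κ (projP κ *
        Ring.inverse (1 - hankelOp (symB a) * projQ n * hankelOp (tilde (symC a)) * projQ κ) *
        toeplitzOp (shiftSymbol (-(n : ℤ)) (symB a)) * projP κ) := by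
  obtain ⟨p, p', m, m', hp, hm, hpp, hmm, hmp, hp0, hp0', hm0, hm0', hm1⟩ :=
    exists_wienerHopf haw (summable_fourierCoef_symbolLog hβ ha haw)
  have hppt : ∀ t, p t * p' t = 1 := fun t => DFunLike.congr_fun hpp t
  have hmmt : ∀ t, m t * m' t = 1 := fun t => DFunLike.congr_fun hmm t
  set N := n + κ with hN
  let A : C(Circle, ℂ) := m * p
  have hA : a = A := funext hmp
  let b : C(Circle, ℂ) := m * p'
  let c : C(Circle, ℂ) := m' * p
  have hb : symB a = b := funext fun t => by
    rw [symB, ← hp, ← hm]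
    exact congrArg _ (inv_eq_of_mul_eq_one_right (hppt t))
  have hc : symC a = c := funext fun t => by
    rw [symC, ← hp, ← hm, inv_eq_of_mul_eq_one_right (hmmt t), mul_comm]
    rfl
  have hTA : toeplitzOp A = toeplitzOp m * toeplitzOp p := toeplitzOp_mul_of_nonpos hm0 p
  have hTb : toeplitzOp b = toeplitzOp m * toeplitzOp p' := toeplitzOp_mul_of_nonpos hm0 p'
  have hTc : toeplitzOp c = toeplitzOp m' * toeplitzOp p := toeplitzOp_mul_of_nonpos hm0' p
  have hone : ∀ f g : C(Circle, ℂ), (∀ t, f t * g t = 1) → toeplitzOp (fun t => f t * g t) = 1 :=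
    fun f g h => by
      rw [funext h]
      exact toeplitzOp_one
  have hll : toeplitzOp p' * toeplitzOp p = 1 := by
    rw [← toeplitzOp_mul_of_nonneg p' hp0]
    exact hone _ _ fun t => by rw [mul_comm, hppt]
  have hll' : toeplitzOp p * toeplitzOp p' = 1 := by
    rw [← toeplitzOp_mul_of_nonneg p hp0']
    exact hone _ _ hppt
  have huu : toeplitzOp m * toeplitzOp m' = 1 := by
    rw [← toeplitzOp_mul_of_nonpos hm0 m']
    exact hone _ _ hmmt
  have huu' : toeplitzOp m' * toeplitzOp m = 1 := by
    rw [← toeplitzOp_mul_of_nonpos hm0' m]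
    exact hone _ _ fun t => by rw [mul_comm, hmmt]
  -- The product formula for `bc = 1`, followed by factoring `T(b)` and `T(c)` into triangular
  -- operators.
  have hk : 1 - hankelOp b * hankelOp (tilde c) =
      toeplitzOp m * toeplitzOp p' * (toeplitzOp m' * toeplitzOp p) := by
    rw [← hTb, ← hTc, sub_eq_iff_eq_add, ← toeplitzOp_mul]
    refine (hone _ _ fun t => ?_).symm
    calc m t * p' t * (m' t * p t) = (m t * m' t) * (p t * p' t) := by ring
      _ = 1 := by rw [hmmt, hppt, mul_one]
  have hlow : ∀ f : C(Circle, ℂ), (∀ k < 0, fourierCoef f k = 0) →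
      ∀ j k, j < k → toeplitzOp f (basisVec k) j = 0 := fun f hf j k hjk => by
    rw [toeplitzOp_apply _ f.continuous, hf _ (by omega)]
  have hupp : ∀ f : C(Circle, ℂ), (∀ k > 0, fourierCoef f k = 0) →
      ∀ j k, k < j → toeplitzOp f (basisVec k) j = 0 := fun f hf j k hjk => by
    rw [toeplitzOp_apply _ f.continuous, hf _ (by omega)]
  subst hA
  have hcorner : cornerMatrix N (toeplitzOp m * toeplitzOp p) = toeplitzMatrix N A := by
    ext j k
    rw [← hTA]
    -- The block `u * l'` of the abstract lemma is therefore `T_N(a)`, which `R` inverts.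
    exact toeplitzOp_apply _ A.continuous j k
  have hdet := (Matrix.isUnit_iff_isUnit_det _).1 hT
  set R := (toeplitzMatrix N A)⁻¹ with hR
  obtain ⟨x, hx1, hx2, hx3⟩ := exists_inverse_of_triangular hll hll' huu huu'
    (projP_mul_projP le_rfl) (projP_mul_eq_of_lower (hlow p' hp0') N)
    (projP_mul_eq_of_lower (hlow p hp0) N) (mul_projP_eq_of_upper (hupp m hm0) N)
    (mul_projP_eq_of_upper (hupp m' hm0') N) (projP_mul_extendOp R) (extendOp_mul_projP R)
    (extendOp_mul_mul_projP (by rw [hcorner]; exact Matrix.nonsing_inv_mul _ hdet))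
    (projP_mul_mul_extendOp (by rw [hcorner]; exact Matrix.mul_nonsing_inv _ hdet)) hk
  have hQ : ∀ k, (1 : ℓ²(ℕ, ℂ) →L[ℂ] ℓ²(ℕ, ℂ)) - projP k = projQ k := fun k => rfl
  rw [hQ] at hx1 hx2
  have hQP : projQ N * projP n = 0 := by
    rw [projQ, sub_mul, one_mul, projP_mul_projP (Nat.le_add_right n κ), sub_self]
  -- `Q_N P_n = 0`, so the first operator fixes the range of `P_n`, which the shift compression
  -- discards.
  obtain ⟨hz1, hz2, hz3⟩ := compression_inverse (toeplitzOp_circlePow_neg_mul n)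
    (by rw [toeplitzOp_circlePow_mul_neg, projQ]) hx1 hx2
    (q := projP n) (by rw [sub_mul, one_mul, mul_assoc, hQP, mul_zero, sub_zero])
  have htc : hankelOp (tilde c) * toeplitzOp (circlePow n) =
      toeplitzOp (circlePow (-n)) * hankelOp (tilde c) :=
    hankelOp_mul_toeplitzOp_circlePow ⟨tilde c, continuous_tilde c⟩ n
  have hz : 1 - hankelOp b * projQ n * hankelOp (tilde c) * projQ κ =
      toeplitzOp (circlePow (-n)) * (1 - hankelOp b * hankelOp (tilde c) * projQ N) *
        toeplitzOp (circlePow n) := by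
    have h : hankelOp b * projQ n * hankelOp (tilde c) * projQ κ =
        toeplitzOp (circlePow (-n)) * (hankelOp b * hankelOp (tilde c) * projQ N) *
          toeplitzOp (circlePow n) := by
      calc _ = hankelOp b * toeplitzOp (circlePow n) *
            (toeplitzOp (circlePow (-n)) * hankelOp (tilde c)) * projQ κ := by
              rw [← toeplitzOp_circlePow_mul_neg]; simp only [mul_assoc]
        _ = toeplitzOp (circlePow (-n)) * hankelOp b * hankelOp (tilde c) *
            (toeplitzOp (circlePow n) * projQ κ) := by
              rw [hankelOp_mul_toeplitzOp_circlePow, ← htc]; simp only [mul_assoc]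
        _ = _ := by rw [toeplitzOp_circlePow_mul_projQ]; simp only [mul_assoc, hN]
    rw [mul_sub, sub_mul, mul_one, toeplitzOp_circlePow_neg_mul, h]
  rw [← hz] at hz1 hz2
  obtain ⟨hu1, hi1⟩ := isUnit_and_inverse_eq hx1 hx2
  obtain ⟨hu2, hi2⟩ := isUnit_and_inverse_eq hz1 hz2
  have hshift : toeplitzOp (shiftSymbol (-(n : ℤ)) b) =
      toeplitzOp (circlePow (-n)) * toeplitzOp b :=
    toeplitzOp_mul_of_nonpos (f := circlePow (-n)) (fun k hk => by
      rw [fourierCoef_circlePow, if_neg (by omega)]) b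
  have hF : (cornerMatrix κ (toeplitzOp (circlePow (-n)) * x * toeplitzOp b)).det =
      (R.submatrix (Fin.natAdd n) (Fin.castLE (Nat.le_add_left κ n))).det := by
    have h0 : ∀ i j : Fin N, cornerMatrix N (toeplitzOp m) i j = fourierCoef m ((i : ℤ) - j) :=
      fun i j => toeplitzOp_apply _ m.continuous _ _
    -- The diagonal of `T(a_-)` is 1 because the exponent of `a_-` has no constant term.
    rw [← det_corner_upperTriangular_mul n κ (cornerMatrix N (toeplitzOp m)) R
      (fun i j hij => hupp m hm0 _ _ hij) (fun i => by rw [h0, sub_self, hm1])]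
    congr 1
    ext j k
    -- Row `j` after the backward shift is row `n + j < N` before it, so inserting `P_N` changes
    -- nothing.
    rw [Matrix.submatrix_apply, ← mul_extendOp_mul_apply, ← hx3, mul_assoc (projP N),
      projP_mul_apply, if_pos (Fin.isLt _), ← hTb, cornerMatrix, Matrix.of_apply, mul_assoc,
      mul_apply_eq_comp, toeplitzOp_circlePow_neg_apply, Fin.val_natAdd, Fin.val_castLE,
      add_comm n]
  rw [hb, hc]
  refine ⟨hu1, hu2, _, toeplitzDet_shiftSymbol A n κ hT, ?_, ?_⟩
  · rw [hi1, ← hF, ← cornerDet_projP]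
    simp only [mul_assoc]
    rfl
  · rw [hi2, ← hF, hshift, ← cornerDet_projP, ← hz3]
    simp only [mul_assoc]
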